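/- Let $m>1$ be an integer, and for $\tau\in\mathbb C$ with $\operatorname{Im}\tau>0$ write $q^s:=e^{2\pi i s\tau}$ and $\zeta:=e^{2\pi i z}$. Let $\mathrm{ch}F_r(\tau)=\mathrm{ch}F_{r,m}(\tau)$, $r\in\mathbb Z$, be the Laurent coefficients (given by Cauchy's formula on $|\zeta|=1$) in the expansion $$\sum_{r\in\mathbb Z}\mathrm{ch}F_r(\tau)\,\zeta^r=\prod_{k\ge1}\frac{\left(1+\zeta q^{k-\frac12}\right)^m\left(1+\zeta^{-1}q^{k-\frac12}\right)^m}{\left(1-\zeta q^{k-\frac12}\right)^m\left(1-\zeta^{-1}q^{k-\frac12}\right)^m},\qquad |\operatorname{Im} z|<\tfrac12\operatorname{Im}\tau ,$$ of the specialized Kac–Wakimoto generating function, and let $$\mathrm{tr}_{L_{m,m}(\Lambda_{(r)})}q^{L_0}:=\mathrm{ch}F_r(\tau)\prod_{k\ge1}(1-q^k)$$ be the specialized Kac–Wakimoto $s\ell(m|m)^\wedge$-character. Define the higher Euler numbers $\mathscr E_{k,n}$ ($k\ge0$, $n\ge1$) by $$\mathscr E_{k,1}=(-2i)^{-k}E_k,\qquad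 \mathscr E_{k,2}=\frac{2i^{-k}}{\pi}B_k\!\left(\tfrac12\right),\qquad \mathscr E_{k,n+2}=\frac{n}{n+1}\mathscr E_{k,n}-\frac{k(k-1)}{\pi^2n(n+1)}\mathscr E_{k-2,n},$$ with $\mathscr E_{k,n}:=0$ for $k<0$, where $E_k=2^kE_k(\tfrac12)$ are the Euler numbers and the Euler and Bernoulli polynomials are given by $\sum_{k\ge0}E_k(z)\frac{x^k}{k!}=\frac{2e^{xz}}{e^x+1}$ and $\sum_{k\ge0}B_k(z)\frac{x^k}{k!}=\frac{xe^{xz}}{e^x-1}$. Then the stated Laurent expansion holds, and for every $r\in\mathbb Z$ and every integer $N\ge0$, with $\tau=it$ and $t\to0^+$, $$\mathrm{tr}_{L_{m,m}(\Lambda_{(r)})}q^{L_0}=e^{\frac{\pi t}{12}+\frac{\pi}{12t}(3m-1)}\,\frac{\sqrt t}{2^m}\left(\sum_{k=0}^{N}a_k(m,r)\frac{t^k}{k!}+O\!\left(t^{N+1}\right)\right),\qquad a_k(m,r):=(-2\pi i r)^k\,\mathscr E_{k,m},$$ where the implied constant may depend on $m$, $r$ and $N$. -/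

import Mathlib

open scoped Topology Asymptotics

noncomputable section

namespace KacWakimoto

/-- The power `q ^ s` of the nome `q = exp (2 π i τ)`. -/
def qPow (τ : ℂ) (s : ℂ) : ℂ := Complex.exp (2 * Real.pi * Complex.I * s * τ)

/-- The specialized Kac-Wakimoto generating function for `sl(m|m)^`, in the variables `τ` and `ζ`
(all the formal variables are set equal to `1`):
`∏_{k ≥ 1} ((1 + ζ q^(k-1/2)) (1 + ζ⁻¹ q^(k-1/2)))^m / ((1 - ζ q^(k-1/2)) (1 - ζ⁻¹ q^(k-1/2)))^m`.
The index `k` starts at `0` here, so that the exponent is `k + 1/2`. -/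
def genF (m : ℕ) (τ ζ : ℂ) : ℂ :=
  ∏' k : ℕ,
    ((1 + ζ * qPow τ (k + 1 / 2)) ^ m * (1 + ζ⁻¹ * qPow τ (k + 1 / 2)) ^ m) /
      ((1 - ζ * qPow τ (k + 1 / 2)) ^ m * (1 - ζ⁻¹ * qPow τ (k + 1 / 2)) ^ m)

/-- The `r`-th Laurent coefficient of the generating function with respect to `ζ = exp (2 π i z)`,
in the annulus `|q|^(1/2) < |ζ| < |q|^(-1/2)`, which contains the unit circle
(Cauchy's formula on the unit circle). -/
def chF (m : ℕ) (r : ℤ) (τ : ℂ) : ℂ :=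
  ∫ u in (-(1 / 2) : ℝ)..(1 / 2),
    genF m τ (Complex.exp (2 * Real.pi * Complex.I * u)) *
      Complex.exp (-(2 * Real.pi * Complex.I * r * u))

/-- The specialized character `tr q^(L_0)` of the module `L_{m,m}(Λ_(r))`:
`chF_r(τ) * ∏_{k ≥ 1} (1 - q^k)`. -/
def trL (m : ℕ) (r : ℤ) (τ : ℂ) : ℂ :=
  chF m r τ * ∏' k : ℕ, (1 - qPow τ (k + 1))

/-- The Euler polynomials, evaluated at `z`: `∑ E_k(z) x^k / k! = 2 e^(x z) / (e^x + 1)`. -/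
def eulerPoly (k : ℕ) (z : ℂ) : ℂ :=
  (k.factorial : ℂ) * PowerSeries.coeff k
    (2 * PowerSeries.rescale z (PowerSeries.exp ℂ) * (PowerSeries.exp ℂ + 1)⁻¹)

/-- The Euler numbers `E_k = 2^k E_k(1/2)`, that is `1, 0, -1, 0, 5, 0, -61, ...`. -/
def eulerNumber (k : ℕ) : ℂ := 2 ^ k * eulerPoly k (1 / 2)

/-- The higher Euler numbers `𝓔_{k,n}` for `n ≥ 1`: `𝓔_{k,1} = (-2i)^(-k) E_k`,
`𝓔_{k,2} = (2 i^(-k) / π) B_k(1/2)`, and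
`𝓔_{k,n+2} = n/(n+1) 𝓔_{k,n} - k(k-1)/(π² n (n+1)) 𝓔_{k-2,n}`, where `𝓔_{k-2,n} = 0` if `k < 2`.
The value at `n = 0` is a dummy that enters nowhere. -/
def higherEuler (k : ℕ) : ℕ → ℂ
  | 0 => 0
  | 1 => (-2 * Complex.I) ^ (-(k : ℤ)) * eulerNumber k
  | 2 => 2 * Complex.I ^ (-(k : ℤ)) / Real.pi *
      Polynomial.aeval (1 / 2 : ℂ) (Polynomial.bernoulli k)
  | n + 3 =>
      ((n : ℂ) + 1) / ((n : ℂ) + 2) * higherEuler k (n + 1) -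
        (k : ℂ) * ((k : ℂ) - 1) / ((Real.pi : ℂ) ^ 2 * ((n : ℂ) + 1) * ((n : ℂ) + 2)) *
          (if k < 2 then 0 else higherEuler (k - 2) (n + 1))

/-- The coefficients `a_k(m, r) = (-2 π i r)^k 𝓔_{k,m}`. -/
def coeffA (k m : ℕ) (r : ℤ) : ℂ :=
  (-2 * Real.pi * Complex.I * r) ^ k * higherEuler k m

end KacWakimoto

end

noncomputable section

namespace KacWakimoto

/-! For `τ = i t` the quasi-periodicity of the product `tripleProd` makes it a constant multiple of
`jacobiTheta₂`, and replacing ζ by -ζ is the shift z ↦ z + 1/2, so the generating function is the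
m-th power of a quotient of two theta values (`genF_eq`, `exists_tripleProd_eq_jacobiTheta₂`).
Modular inversion turns both values into periodized Gaussians of width about √t. For |u| ≤ 1/2 the
term n = 0 dominates the numerator and the terms n = 0, 1 the denominator, so the quotient is close
to e^{π/(4t)} / (2 cosh(πu/t)); after normalization its m-th power is sech^m(πu/t) up to
O(e^{-π/t}), uniformly in u (`exists_gaussSum_quotient_bound`).

Substituting u = t v, the Laurent coefficient becomes t times the Fourier transform of sech^m(πv) at
frequency r t, up to terms beyond all orders. Taylor expansion of the exponential then produces the
moments ∫ v^k sech^m(πv) dv as coefficients.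

These moments are the higher Euler numbers (`higherEuler_eq_sechMoment`): integration by parts gives
the recursion in n, and for n = 1, 2 a contour shift across the strip |Im w| ≤ 1/2 shows that the
exponential generating series of the moments are 1/cos(x/2) and (x/π)/sin(x/2), the Euler and
Bernoulli generating functions at an imaginary argument.

The factor ∏(1 - q^k) is handled by the inversion of the eta function: it supplies the remaining
exponential prefactor and a power of t, times an Euler function in e^{-2π/t} that is 1 up to terms
beyond all orders. -/

/-! ### Fourier coefficients and Laurent expansion of periodic functions on a strip -/

open Complex in
/-- The mean of a `1`-periodic holomorphic function along horizontal segments is constant. -/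
lemma integral_shift_of_periodic {F : ℂ → ℂ} {T : ℝ}
    (hF : DifferentiableOn ℂ F {z | |z.im| < T}) (hper : ∀ z, F (z + 1) = F z)
    {y : ℝ} (hy : |y| < T) :
    ∫ u in (-(1 / 2) : ℝ)..(1 / 2), F (u + y * I) = ∫ u in (-(1 / 2) : ℝ)..(1 / 2), F u := by
  have h := integral_boundary_rect_eq_zero_of_differentiableOn F (-(1 / 2) : ℝ)
    ((1 / 2 : ℝ) + y * I) (hF.mono ?_)
  · have h2 : ∀ v : ℝ, F (((1 / 2 : ℝ) : ℂ) + v * I) = F (((-(1 / 2) : ℝ) : ℂ) + v * I) := by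
      intro v
      rw [← hper (((-(1 / 2) : ℝ) : ℂ) + v * I)]
      congr 1
      push_cast
      ring
    simp only [ofReal_re, ofReal_im, add_re, add_im, mul_re, mul_im, I_re, I_im, mul_zero, mul_one,
      sub_zero, zero_add, add_zero, ofReal_zero, zero_mul] at h
    simp only [h2] at h
    linear_combination -h
  · rintro z hz
    have hz2 := hz.2
    simp only [Set.mem_preimage, ofReal_im, add_im, mul_im, ofReal_re, I_im, I_re, mul_one,
      mul_zero, add_zero, zero_add, Set.mem_uIcc] at hz2
    simp only [Set.mem_ofPred_eq]
    rw [abs_lt] at hy ⊢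
    rcases hz2 with h | h <;> constructor <;> linarith

open Complex in
lemma mul_exp_periodic {F : ℂ → ℂ} (hper : ∀ z, F (z + 1) = F z) (r : ℤ) (z : ℂ) :
    F (z + 1) * exp (-(2 * Real.pi * I * r * (z + 1))) = F z * exp (-(2 * Real.pi * I * r * z)) := by
  rw [hper, show -(2 * Real.pi * I * r * (z + 1)) =
    -(2 * Real.pi * I * r * z) + (-r : ℤ) * (2 * Real.pi * I) by push_cast; ring, exp_add,
    exp_int_mul_two_pi_mul_I, mul_one]

open Complex in
/-- Fourier coefficients of a `1`-periodic holomorphic function may be computed on any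
horizontal line. -/
lemma integral_mul_exp_shift {F : ℂ → ℂ} {T : ℝ}
    (hF : DifferentiableOn ℂ F {z | |z.im| < T}) (hper : ∀ z, F (z + 1) = F z)
    {y : ℝ} (hy : |y| < T) (r : ℤ) :
    ∫ u in (-(1 / 2) : ℝ)..(1 / 2), F (u + y * I) * exp (-(2 * Real.pi * I * r * (u + y * I))) =
      ∫ u in (-(1 / 2) : ℝ)..(1 / 2), F u * exp (-(2 * Real.pi * I * r * u)) :=
  integral_shift_of_periodic (F := fun z => F z * exp (-(2 * Real.pi * I * r * z)))
    (hF.mul (by fun_prop)) (mul_exp_periodic hper r) hy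

open Complex in
lemma norm_exp_neg_mul_line (r : ℤ) (u y : ℝ) :
    ‖exp (-(2 * Real.pi * I * r * (u + y * I)))‖ = Real.exp (2 * Real.pi * r * y) := by
  rw [norm_exp]
  congr 1
  simp

open Complex in
lemma continuous_line {F : ℂ → ℂ} {T : ℝ} (hF : DifferentiableOn ℂ F {z | |z.im| < T})
    {y : ℝ} (hy : |y| < T) : Continuous (fun u : ℝ => F (u + y * I)) :=
  hF.continuousOn.comp_continuous (by fun_prop) (by intro u; simpa using hy)

-- Since M does not depend on r, using this at heights y and -y gives exponential decay of the
-- coefficients in |r|.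
open Complex in
lemma norm_fourier_coeff_le {F : ℂ → ℂ} {T : ℝ}
    (hF : DifferentiableOn ℂ F {z | |z.im| < T}) (hper : ∀ z, F (z + 1) = F z)
    {y : ℝ} (hy : |y| < T) : ∃ M : ℝ, ∀ r : ℤ,
    ‖∫ u in (-(1 / 2) : ℝ)..(1 / 2), F u * exp (-(2 * Real.pi * I * r * u))‖ ≤
      M * Real.exp (2 * Real.pi * r * y) := by
  obtain ⟨M, hM⟩ := (isCompact_Icc (a := (-(1 / 2) : ℝ)) (b := 1 / 2)).exists_bound_of_continuousOn
    (continuous_line hF hy).continuousOn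
  refine ⟨M, fun r => ?_⟩
  rw [← integral_mul_exp_shift hF hper hy r]
  refine (intervalIntegral.norm_integral_le_of_norm_le_const
    (C := M * Real.exp (2 * Real.pi * r * y)) fun u hu => ?_).trans (by norm_num)
  rw [norm_mul, norm_exp_neg_mul_line]
  rw [Set.uIoc_of_le (by norm_num)] at hu
  exact mul_le_mul_of_nonneg_right (hM u ⟨hu.1.le, hu.2⟩) (Real.exp_pos _).le

lemma summable_exp_neg_mul_abs {d : ℝ} (hd : 0 < d) :
    Summable (fun r : ℤ => Real.exp (-(d * |(r : ℝ)|))) := by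
  have h : Summable (fun n : ℕ => Real.exp (-d) ^ n) :=
    summable_geometric_of_lt_one (Real.exp_pos _).le (by simpa using hd)
  refine Summable.of_nat_of_neg ?_ ?_ <;>
  · refine h.congr fun n => ?_
    rw [← Real.exp_nat_mul]
    congr 1
    simp
    ring

open Complex in
/-- The Laurent expansion of a `1`-periodic holomorphic function on a horizontal strip. -/
lemma hasSum_laurent_of_periodic {F : ℂ → ℂ} {T : ℝ}
    (hF : DifferentiableOn ℂ F {z | |z.im| < T}) (hper : ∀ z, F (z + 1) = F z)
    {z : ℂ} (hz : |z.im| < T) :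
    HasSum (fun r : ℤ => (∫ u in (-(1 / 2) : ℝ)..(1 / 2), F u * exp (-(2 * Real.pi * I * r * u))) *
      exp (2 * Real.pi * I * z) ^ r) (F z) := by
  set c : ℤ → ℂ := fun r =>
    ∫ u in (-(1 / 2) : ℝ)..(1 / 2), F u * exp (-(2 * Real.pi * I * r * u)) with hc
  set y := z.im with hy
  -- Bounds on the lines Im = ±Y, with Y strictly above |Im z|, leave a net decay rate 2π(Y - |y|) >
  -- 0 after multiplication by |ζ|^r.
  obtain ⟨Y, hyY, hYT⟩ := exists_between hz
  have hY0 : 0 < Y := (abs_nonneg _).trans_lt hyY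
  have hYabs : |Y| < T := by rwa [abs_of_pos hY0]
  obtain ⟨M₁, h₁⟩ := norm_fourier_coeff_le hF hper hYabs
  obtain ⟨M₂, h₂⟩ := norm_fourier_coeff_le hF hper (y := -Y) (by rwa [abs_neg])
  have hbound : ∀ r : ℤ, ‖c r * (Real.exp (-(2 * Real.pi * r * y)) : ℝ)‖ ≤
      (|M₁| + |M₂|) * Real.exp (-((2 * Real.pi * (Y - |y|)) * |(r : ℝ)|)) := by
    intro r
    have hcr : ‖c r‖ ≤ (|M₁| + |M₂|) * Real.exp (-(2 * Real.pi * Y * |(r : ℝ)|)) := by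
      rcases le_total 0 (r : ℝ) with hr | hr
      · refine (h₂ r).trans ?_
        rw [abs_of_nonneg hr]
        refine mul_le_mul ((le_abs_self _).trans (by linarith [abs_nonneg M₁])) (le_of_eq ?_)
          (Real.exp_pos _).le (by positivity)
        congr 1; ring
      · refine (h₁ r).trans ?_
        rw [abs_of_nonpos hr]
        refine mul_le_mul ((le_abs_self _).trans (by linarith [abs_nonneg M₂])) (le_of_eq ?_)
          (Real.exp_pos _).le (by positivity)
        congr 1; ring
    rw [norm_mul, norm_real, Real.norm_of_nonneg (Real.exp_pos _).le]
    calc ‖c r‖ * Real.exp (-(2 * Real.pi * r * y))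
        ≤ (|M₁| + |M₂|) * Real.exp (-(2 * Real.pi * Y * |(r : ℝ)|)) *
            Real.exp (2 * Real.pi * (|(r : ℝ)| * |y|)) := by
          refine mul_le_mul hcr (Real.exp_le_exp.mpr ?_) (Real.exp_pos _).le (by positivity)
          have := neg_abs_le ((r : ℝ) * y)
          rw [abs_mul] at this
          nlinarith [Real.pi_pos]
      _ = _ := by
          rw [mul_assoc, ← Real.exp_add]
          congr 2; ring
  have hfper : Function.Periodic (fun u : ℝ => F (u + y * I)) 1 := by
    intro u
    simp only
    rw [← hper (u + y * I)]
    congr 1; push_cast; ring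
  -- The Laurent series at z is the Fourier series of the restriction of F to the horizontal line
  -- through z.
  let f : C(AddCircle (1 : ℝ), ℂ) :=
    ⟨hfper.lift, continuous_coinduced_dom.mpr (continuous_line hF hz)⟩
  have hf : ∀ u : ℝ, f u = F (u + y * I) := fun u => rfl
  have hcoeff : ∀ r : ℤ, fourierCoeff f r = c r * (Real.exp (-(2 * Real.pi * r * y)) : ℝ) := by
    intro r
    rw [fourierCoeff_eq_intervalIntegral f r (-(1 / 2) : ℝ)]
    rw [show (-(1 / 2) + 1 : ℝ) = 1 / 2 by norm_num]
    simp only [hc]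
    rw [← integral_mul_exp_shift hF hper hz r, ← intervalIntegral.integral_mul_const]
    simp only [div_one, one_smul, smul_eq_mul]
    congr 1
    ext u
    rw [hf, fourier_coe_apply, ofReal_exp, mul_assoc (F _), ← exp_add, mul_comm]
    congr 2
    push_cast
    linear_combination (2 * Real.pi * r * y : ℂ) * I_mul_I
  have hsum : Summable (fourierCoeff f) := by
    refine Summable.of_norm_bounded ((summable_exp_neg_mul_abs
      (d := 2 * Real.pi * (Y - |y|)) ?_).mul_left (|M₁| + |M₂|)) fun r => ?_
    · have : 0 < Y - |y| := by linarith
      positivity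
    · rw [hcoeff]; exact hbound r
  have key := has_pointwise_sum_fourier_series_of_summable hsum (z.re : AddCircle (1 : ℝ))
  rw [hf, hy, re_add_im] at key
  refine key.congr_fun fun r => ?_
  rw [hcoeff, fourier_coe_apply, smul_eq_mul, ← exp_int_mul, ofReal_exp, mul_assoc (c r), ← exp_add]
  congr 2
  have := re_add_im z
  push_cast
  conv_lhs => rw [← this]
  rw [hy]
  linear_combination (2 * Real.pi * r * z.im : ℂ) * I_mul_I

/-! ### Euler products and the product form of the generating function -/

/-- The Euler product `∏_{k ≥ 0} (1 + x Q^k)`. -/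
def eulerProd (Q x : ℂ) : ℂ := ∏' k : ℕ, (1 + x * Q ^ k)

lemma summable_norm_mul_pow {Q : ℂ} (hQ : ‖Q‖ < 1) (x : ℂ) :
    Summable fun k : ℕ => ‖x * Q ^ k‖ := by
  simp only [norm_mul, norm_pow]
  exact (summable_geometric_of_lt_one (norm_nonneg _) hQ).mul_left _

lemma multipliable_eulerProd {Q : ℂ} (hQ : ‖Q‖ < 1) (x : ℂ) :
    Multipliable fun k : ℕ => 1 + x * Q ^ k :=
  multipliable_one_add_of_summable (summable_norm_mul_pow hQ x)

lemma eulerProd_eq {Q : ℂ} (hQ : ‖Q‖ < 1) (x : ℂ) :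
    eulerProd Q x = (1 + x) * eulerProd Q (x * Q) := by
  have e : (fun k : ℕ => 1 + x * Q ^ (k + 1)) = fun k : ℕ => 1 + x * Q * Q ^ k := by
    ext k; ring
  have h : Multipliable fun k : ℕ => 1 + x * Q ^ (k + 1) := by
    rw [e]; exact multipliable_eulerProd hQ (x * Q)
  have h2 := tprod_eq_zero_mul' (f := fun k : ℕ => 1 + x * Q ^ k) h
  rw [e, pow_zero, mul_one] at h2
  exact h2

lemma one_add_mul_pow_ne_zero {Q x : ℂ} (hQ : ‖Q‖ < 1) (hx : ‖x‖ < 1) (k : ℕ) :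
    1 + x * Q ^ k ≠ 0 := by
  intro h
  have h1 : x * Q ^ k = -1 := by linear_combination h
  have h2 : ‖x * Q ^ k‖ = 1 := by simp [h1]
  have h3 : ‖x * Q ^ k‖ ≤ ‖x‖ := by
    rw [norm_mul, norm_pow]
    exact mul_le_of_le_one_right (norm_nonneg _) (pow_le_one₀ (norm_nonneg _) hQ.le)
  linarith

lemma eulerProd_ne_zero {Q x : ℂ} (hQ : ‖Q‖ < 1) (hx : ‖x‖ < 1) : eulerProd Q x ≠ 0 :=
  tprod_one_add_ne_zero_of_summable (one_add_mul_pow_ne_zero hQ hx) (summable_norm_mul_pow hQ x)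

lemma differentiable_eulerProd {Q : ℂ} (hQ : ‖Q‖ < 1) : Differentiable ℂ (eulerProd Q) := by
  intro x
  have hlu : HasProdLocallyUniformlyOn (fun (k : ℕ) (x : ℂ) => 1 + x * Q ^ k)
      (fun x => ∏' k : ℕ, (1 + x * Q ^ k)) (Metric.ball 0 (‖x‖ + 1)) := by
    refine Summable.hasProdLocallyUniformlyOn_nat_one_add Metric.isOpen_ball
      (u := fun k => (‖x‖ + 1) * ‖Q‖ ^ k)
      ((summable_geometric_of_lt_one (norm_nonneg _) hQ).mul_left _)
      (.of_forall fun k y hy => ?_) (fun k => by fun_prop)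
    rw [norm_mul, norm_pow]
    exact mul_le_mul_of_nonneg_right (by simpa using (Metric.mem_ball.mp hy).le) (by positivity)
  have := hlu.differentiableOn
    (.of_forall fun s => by
      simpa [Finset.prod_fn] using! DifferentiableOn.finsetProd (fun _ _ ↦ by fun_prop))
    Metric.isOpen_ball
  exact this.differentiableAt (Metric.isOpen_ball.mem_nhds (by simp))

/-- The product `∏ (1 + ζ q^(k-1/2)) (1 + ζ⁻¹ q^(k-1/2))`, with `ζ = exp (2 π i z)`. -/
def tripleProd (τ z : ℂ) : ℂ :=
  eulerProd (qPow τ 1) (Complex.exp (2 * Real.pi * Complex.I * (z + τ / 2))) *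
    eulerProd (qPow τ 1) (Complex.exp (2 * Real.pi * Complex.I * (-z + τ / 2)))

open Complex in
lemma norm_exp_two_pi_I_mul (w : ℂ) :
    ‖exp (2 * Real.pi * I * w)‖ = Real.exp (-(2 * Real.pi * w.im)) := by
  rw [norm_exp]; congr 1; simp

open Complex in
lemma norm_exp_two_pi_I_mul_lt_one {w : ℂ} (hw : 0 < w.im) :
    ‖exp (2 * Real.pi * I * w)‖ < 1 := by
  rw [norm_exp_two_pi_I_mul, Real.exp_lt_one_iff]
  have := Real.pi_pos
  nlinarith [mul_pos this hw]

lemma norm_qPow_one_lt {τ : ℂ} (hτ : 0 < τ.im) : ‖qPow τ 1‖ < 1 := by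
  rw [qPow, mul_one]
  exact norm_exp_two_pi_I_mul_lt_one hτ

lemma differentiable_tripleProd {τ : ℂ} (hτ : 0 < τ.im) : Differentiable ℂ (tripleProd τ) := by
  have h := differentiable_eulerProd (norm_qPow_one_lt hτ)
  exact (h.comp (by fun_prop)).mul (h.comp (by fun_prop))

open Complex in
lemma exp_two_pi_I_mul_add_one (w : ℂ) :
    exp (2 * Real.pi * I * (w + 1)) = exp (2 * Real.pi * I * w) := by
  rw [mul_add, mul_one, exp_periodic]

lemma tripleProd_add_one (τ z : ℂ) : tripleProd τ (z + 1) = tripleProd τ z := by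
  rw [tripleProd, tripleProd, show z + 1 + τ / 2 = z + τ / 2 + 1 by ring,
    exp_two_pi_I_mul_add_one, ← exp_two_pi_I_mul_add_one (-(z + 1) + τ / 2)]
  congr 4
  ring

lemma tripleProd_ne_zero {τ z : ℂ} (hz : |z.im| < τ.im / 2) : tripleProd τ z ≠ 0 := by
  have hτ : 0 < τ.im := by linarith [abs_nonneg z.im]
  rw [abs_lt] at hz
  have e : (τ / 2).im = τ.im / 2 := by simp
  refine mul_ne_zero (eulerProd_ne_zero (norm_qPow_one_lt hτ) (norm_exp_two_pi_I_mul_lt_one ?_))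
    (eulerProd_ne_zero (norm_qPow_one_lt hτ) (norm_exp_two_pi_I_mul_lt_one ?_))
  · rw [Complex.add_im, e]; linarith
  · rw [Complex.add_im, e, Complex.neg_im]; linarith

-- With X = e^{2πi(z+τ/2)}, the shift moves one factor from each Euler product: 1 + X is lost and 1
-- + X⁻¹ is gained, and their ratio is X⁻¹.
open Complex in
lemma tripleProd_add_tau {τ z : ℂ} (hz : |z.im| < τ.im / 2) :
    tripleProd τ (z + τ) = exp (-(2 * Real.pi * I * (z + τ / 2))) * tripleProd τ z := by
  have hτ : 0 < τ.im := by linarith [abs_nonneg z.im]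
  have hQ := norm_qPow_one_lt hτ
  set X := exp (2 * Real.pi * I * (z + τ / 2)) with hX
  have e1 : exp (2 * Real.pi * I * (z + τ + τ / 2)) = X * qPow τ 1 := by
    rw [hX, qPow, ← exp_add]; congr 1; ring
  have e2 : exp (2 * Real.pi * I * (-(z + τ) + τ / 2)) = X⁻¹ := by
    rw [hX, ← exp_neg]; congr 1; ring
  have e3 : exp (2 * Real.pi * I * (-z + τ / 2)) = X⁻¹ * qPow τ 1 := by
    rw [hX, qPow, ← exp_neg, ← exp_add]; congr 1; ring
  have hX0 : X ≠ 0 := exp_ne_zero _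
  rw [tripleProd, tripleProd, e1, e2, e3, ← hX, exp_neg, ← hX, eulerProd_eq hQ X,
    eulerProd_eq hQ X⁻¹]
  field_simp
  ring

-- The shift by 1/2 changes the sign of ζ, so it turns the numerator product into the denominator
-- product, which does not vanish on this strip.
open Complex in
lemma genF_eq (m : ℕ) {τ z : ℂ} (hz : |z.im| < τ.im / 2) :
    genF m τ (exp (2 * Real.pi * I * z)) =
      (tripleProd τ z / tripleProd τ (z + 1 / 2)) ^ m := by
  have hτ : 0 < τ.im := by linarith [abs_nonneg z.im]
  have hQ := norm_qPow_one_lt hτ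
  set Q := qPow τ 1 with hQdef
  have hq : ∀ k : ℕ, qPow τ (k + 1 / 2) = exp (2 * Real.pi * I * (τ / 2)) * Q ^ k := by
    intro k
    rw [hQdef, qPow, qPow, ← exp_nat_mul, ← exp_add]; congr 1; ring
  set a := exp (2 * Real.pi * I * (z + τ / 2)) with ha
  set b := exp (2 * Real.pi * I * (-z + τ / 2)) with hb
  have e1 : ∀ k : ℕ, exp (2 * Real.pi * I * z) * qPow τ (k + 1 / 2) = a * Q ^ k := by
    intro k; rw [hq, ha, ← mul_assoc, ← exp_add, ← mul_add]
  have e2 : ∀ k : ℕ, (exp (2 * Real.pi * I * z))⁻¹ * qPow τ (k + 1 / 2) = b * Q ^ k := by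
    intro k; rw [hq, hb, ← mul_assoc, ← exp_neg, ← exp_add, mul_add, mul_neg]
  have hhalf : exp (2 * Real.pi * I * (1 / 2)) = -1 := by
    rw [← exp_pi_mul_I]; congr 1; ring
  have e3 : exp (2 * Real.pi * I * (z + 1 / 2 + τ / 2)) = -a := by
    rw [ha, ← neg_one_mul, ← hhalf, ← exp_add]; congr 1; ring
  have e4 : exp (2 * Real.pi * I * (-(z + 1 / 2) + τ / 2)) = -b := by
    rw [hb, ← exp_two_pi_I_mul_add_one, ← neg_one_mul (exp _), ← hhalf,
      ← exp_add]
    congr 1; ring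
  have hne : tripleProd τ (z + 1 / 2) ≠ 0 := by
    refine tripleProd_ne_zero ?_
    have : ((1 : ℂ) / 2).im = 0 := by norm_num
    rwa [add_im, this, add_zero]
  have hprod : ∀ x y : ℂ, HasProd (fun k : ℕ => (1 + x * Q ^ k) * (1 + y * Q ^ k))
      (eulerProd Q x * eulerProd Q y) := fun x y =>
    (multipliable_eulerProd hQ x).hasProd.mul (multipliable_eulerProd hQ y).hasProd
  have h1 := hprod a b
  have h2 := hprod (-a) (-b)
  have h2ne : eulerProd Q (-a) * eulerProd Q (-b) ≠ 0 := by
    rw [tripleProd, e3, e4] at hne; exact hne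
  have h3 := ((h1.div₀ h2 h2ne).multipliable.tprod_pow m)
  rw [tripleProd, tripleProd, e3, e4, ← ha, ← hb, ← hQdef, ← (h1.div₀ h2 h2ne).tprod_eq, ← h3, genF]
  refine tprod_congr fun k => ?_
  rw [e1, e2, div_pow, mul_pow, mul_pow]
  simp only [neg_mul, ← sub_eq_add_neg]

/-! ### Jacobi triple product -/

-- The n-th coefficient is computed on the line Im = t, that is at u + τ; the quasi-periodicity
-- factor raises the frequency to n + 1.
open Complex in
lemma tripleProd_fourier_succ {t : ℝ} (ht : 0 < t) (n : ℤ) :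
    ∫ u in (-(1 / 2) : ℝ)..(1 / 2), tripleProd (I * t) u *
        exp (-(2 * Real.pi * I * (n + 1 : ℤ) * u)) =
      exp (2 * Real.pi * I * (I * t) * (n + 1 / 2)) *
      ∫ u in (-(1 / 2) : ℝ)..(1 / 2), tripleProd (I * t) u * exp (-(2 * Real.pi * I * n * u)) := by
  have hτ : 0 < (I * t).im := by simpa using ht
  rw [← integral_mul_exp_shift (T := t + 1) (y := t) (differentiable_tripleProd hτ).differentiableOn
    (tripleProd_add_one _) (by rw [abs_of_pos ht]; linarith) n,
    ← intervalIntegral.integral_const_mul]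
  congr 1
  ext u
  rw [mul_comm (t : ℂ) I, tripleProd_add_tau (by simpa using ht), mul_comm (exp (-_)),
    mul_assoc (tripleProd _ _), ← exp_add, mul_left_comm, ← exp_add]
  congr 2
  push_cast
  ring

open Complex in
/-- The Jacobi triple product identity on the imaginary axis, up to the normalizing factor. -/
lemma exists_tripleProd_eq_jacobiTheta₂ {t : ℝ} (ht : 0 < t) :
    ∃ c : ℂ, ∀ z : ℂ, tripleProd (I * t) z = c * jacobiTheta₂ z (I * t) := by
  have hτ : 0 < (I * t).im := by simpa using ht
  set c : ℤ → ℂ := fun n => ∫ u in (-(1 / 2) : ℝ)..(1 / 2),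
    tripleProd (I * t) u * exp (-(2 * Real.pi * I * n * u)) with hc
  have hsucc : ∀ n : ℤ, c (n + 1) = exp (2 * Real.pi * I * (I * t) * (n + 1 / 2)) * c n :=
    tripleProd_fourier_succ ht
  -- The recursion, solved in both directions, forces the theta coefficients q^{n²/2}. The value of
  -- `c 0` is not needed, because only quotients of two values of the product occur later.
  have hcn : ∀ n : ℤ, c n = c 0 * exp (Real.pi * I * n ^ 2 * (I * t)) := by
    intro n
    induction n using Int.induction_on with
    | zero => simp
    | succ k ih =>
      rw [hsucc, ih, mul_left_comm, ← exp_add]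
      congr 2; push_cast; ring
    | pred k ih =>
      have h := hsucc (-(k : ℤ) - 1)
      rw [sub_add_cancel, ih] at h
      refine mul_left_cancel₀ (exp_ne_zero _) (h.symm.trans ?_)
      rw [mul_left_comm (exp _), ← exp_add]
      congr 2; push_cast; ring
  refine ⟨c 0, fun z => ?_⟩
  have h1 := hasSum_laurent_of_periodic (T := |z.im| + 1) (z := z)
    (differentiable_tripleProd hτ).differentiableOn (tripleProd_add_one _) (by linarith)
  refine h1.unique (((hasSum_jacobiTheta₂_term z hτ).mul_left (c 0)).congr_fun fun n => ?_)
  change c n * _ = _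
  rw [hcn, mul_assoc, ← exp_int_mul, ← exp_add, jacobiTheta₂_term]
  congr 2; ring

/-! ### Gaussian sums and the hyperbolic secant -/

/-- The periodized Gaussian `∑ exp (-π (u - n)² / t)`. -/
def gaussSum (t u : ℝ) : ℝ := ∑' n : ℤ, Real.exp (-(Real.pi * (u - n) ^ 2 / t))

-- This is the modular inversion of theta with the square completed. The prefactor does not depend
-- on u, so it cancels in the quotient of the values at u and u + 1/2.
open Complex in
lemma hasSum_gaussSum {t : ℝ} (ht : 0 < t) (u : ℝ) :
    HasSum (fun n : ℤ => Real.exp (-(Real.pi * (u - n) ^ 2 / t))) (gaussSum t u) ∧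
    ((gaussSum t u : ℝ) : ℂ) = (-I * (I * t)) ^ (1 / 2 : ℂ) * jacobiTheta₂ u (I * t) := by
  have ht' : (t : ℂ) ≠ 0 := by exact_mod_cast ht.ne'
  have him : 0 < (-1 / (I * t) : ℂ).im := by
    rw [show (-1 / (I * t) : ℂ) = ((1 / t : ℝ) : ℂ) * I by
      push_cast; field_simp; rw [I_sq]]
    simpa using ht
  have h := (hasSum_jacobiTheta₂_term (u / (I * t)) him).mul_left
    (exp (-Real.pi * I * u ^ 2 / (I * t)))
  have hterm : ∀ n : ℤ, exp (-Real.pi * I * u ^ 2 / (I * t)) *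
      jacobiTheta₂_term n (u / (I * t)) (-1 / (I * t)) =
      ((Real.exp (-(Real.pi * (u - n) ^ 2 / t)) : ℝ) : ℂ) := by
    intro n
    rw [jacobiTheta₂_term, ← exp_add, ofReal_exp]
    congr 1
    push_cast
    field_simp
    ring
  simp only [hterm] at h
  have hs : Summable fun n : ℤ => Real.exp (-(Real.pi * (u - n) ^ 2 / t)) :=
    Complex.summable_ofReal.mp h.summable
  refine ⟨hs.hasSum, ?_⟩
  rw [gaussSum, ofReal_tsum, h.tsum_eq, jacobiTheta₂_functional_equation u, ← mul_assoc,
    ← mul_assoc, mul_one_div_cancel, one_mul]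
  rw [show -I * (I * t) = t by rw [neg_mul, ← mul_assoc, I_mul_I]; ring]
  exact fun h0 => ht' ((cpow_eq_zero_iff _ _).mp h0).1

open Complex in
/-- On the unit circle and for `τ = i t`, the generating function is a power of a quotient of
periodized Gaussians. -/
lemma genF_eq_gaussSum (m : ℕ) {t : ℝ} (ht : 0 < t) (u : ℝ) :
    genF m (I * t) (exp (2 * Real.pi * I * u)) =
      (((gaussSum t u / gaussSum t (u + 1 / 2)) ^ m : ℝ) : ℂ) := by
  obtain ⟨c, hc⟩ := exists_tripleProd_eq_jacobiTheta₂ ht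
  have hu : |(u : ℂ).im| < (I * t).im / 2 := by simpa using ht
  have hc0 : c ≠ 0 := by
    rintro rfl
    exact tripleProd_ne_zero hu (by rw [hc, zero_mul])
  have ht' : (t : ℂ) ≠ 0 := by exact_mod_cast ht.ne'
  have hk : (-I * (I * t)) ^ (1 / 2 : ℂ) ≠ 0 := by
    rw [show -I * (I * t) = t by rw [neg_mul, ← mul_assoc, I_mul_I]; ring]
    exact fun h0 => ht' ((cpow_eq_zero_iff _ _).mp h0).1
  rw [genF_eq m hu, hc, hc, mul_div_mul_left _ _ hc0]
  push_cast
  rw [(hasSum_gaussSum ht u).2, (hasSum_gaussSum ht (u + 1 / 2)).2, mul_div_mul_left _ _ hk]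
  push_cast
  rfl

lemma summable_exp_neg_pi_mul_abs_sub (a : ℝ) :
    Summable (fun n : ℤ => Real.exp (-(Real.pi * (|(n : ℝ)| - a)))) := by
  refine ((summable_exp_neg_mul_abs Real.pi_pos).mul_left (Real.exp (Real.pi * a))).congr
    fun n => ?_
  rw [← Real.exp_add]
  congr 1; ring

/-- The constant `∑ exp (-π (|n| - 2))` controlling the tails of the Gaussian sums. -/
def gaussTail : ℝ := ∑' n : ℤ, Real.exp (-(Real.pi * (|(n : ℝ)| - 2)))

lemma gaussTail_nonneg : 0 ≤ gaussTail := tsum_nonneg fun _ => (Real.exp_pos _).le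

/-- Splits an exponent in two: B keeps the smallness as t → 0, while t ≤ 1 turns the surplus k into
a factor free of t that can be summed over n. -/
lemma exp_neg_div_le {t A B k : ℝ} (ht : 0 < t) (ht1 : t ≤ 1) (hk : 0 ≤ k) (h : B + k ≤ A) :
    Real.exp (-(Real.pi * A / t)) ≤ Real.exp (-(Real.pi * B / t)) * Real.exp (-(Real.pi * k)) := by
  rw [← Real.exp_add, Real.exp_le_exp]
  have h1 : Real.pi * (B + k) / t ≤ Real.pi * A / t := by
    have := Real.pi_pos
    gcongr
  have h2 : Real.pi * k ≤ Real.pi * k / t := by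
    rw [le_div_iff₀ ht]
    exact mul_le_of_le_one_right (by have := Real.pi_pos; positivity) ht1
  rw [mul_add, add_div] at h1
  linarith

/-- After the term n = 0 is factored out, n² - 2nu ≥ (1 - 2|u|) + (|n| - 1) for n ≠ 0. The bound on
the relative error α degenerates as |u| → 1/2, where a neighbouring Gaussian becomes equally large.
-/
lemma gaussSum_eq_central {t : ℝ} (ht : 0 < t) (ht1 : t ≤ 1) {u : ℝ} (hu : |u| ≤ 1 / 2) :
    ∃ α : ℝ, 0 ≤ α ∧ α ≤ gaussTail * Real.exp (-(Real.pi * (1 - 2 * |u|) / t)) ∧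
      gaussSum t u = Real.exp (-(Real.pi * u ^ 2 / t)) * (1 + α) := by
  obtain ⟨hs, -⟩ := hasSum_gaussSum ht u
  have hs' := hs.mul_left (Real.exp (Real.pi * u ^ 2 / t))
  have hterm : ∀ n : ℤ, Real.exp (Real.pi * u ^ 2 / t) * Real.exp (-(Real.pi * (u - n) ^ 2 / t)) =
      Real.exp (-(Real.pi * ((n : ℝ) ^ 2 - 2 * n * u) / t)) := by
    intro n
    rw [← Real.exp_add]; congr 1; ring
  simp only [hterm] at hs'
  have hsplit := hs'.summable.tsum_eq_add_tsum_ite 0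
  rw [hs'.tsum_eq] at hsplit
  set α := ∑' n : ℤ, (if n = 0 then (0 : ℝ)
    else Real.exp (-(Real.pi * ((n : ℝ) ^ 2 - 2 * n * u) / t))) with hα
  have hle : ∀ n : ℤ, (if n = 0 then (0 : ℝ)
      else Real.exp (-(Real.pi * ((n : ℝ) ^ 2 - 2 * n * u) / t))) ≤
      Real.exp (-(Real.pi * (|(n : ℝ)| - 2))) * Real.exp (-(Real.pi * (1 - 2 * |u|) / t)) := by
    intro n
    split_ifs with hn
    · positivity
    · have hn1 : (1 : ℝ) ≤ |(n : ℝ)| := by exact_mod_cast Int.one_le_abs hn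
      have hnu : (n : ℝ) * u ≤ |(n : ℝ)| * |u| := by rw [← abs_mul]; exact le_abs_self _
      refine (exp_neg_div_le (B := 1 - 2 * |u|) (k := |(n : ℝ)| - 1) ht ht1 (by linarith) ?_).trans ?_
      · rw [← sq_abs (n : ℝ)]
        nlinarith [mul_nonneg (sub_nonneg.mpr hn1) (sub_nonneg.mpr hu)]
      · rw [mul_comm]
        gcongr
        norm_num
  have hnn : ∀ n : ℤ, 0 ≤ (if n = 0 then (0 : ℝ)
      else Real.exp (-(Real.pi * ((n : ℝ) ^ 2 - 2 * n * u) / t))) := by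
    intro n; split_ifs <;> positivity
  have hsum := (summable_exp_neg_pi_mul_abs_sub 2).mul_right
    (Real.exp (-(Real.pi * (1 - 2 * |u|) / t)))
  refine ⟨α, tsum_nonneg hnn, ?_, ?_⟩
  · rw [gaussTail, ← tsum_mul_right]
    exact (Summable.of_nonneg_of_le hnn hle hsum).tsum_le_tsum hle hsum
  · have h0 : Real.exp (-(Real.pi * (((0 : ℤ) : ℝ) ^ 2 - 2 * ((0 : ℤ) : ℝ) * u) / t)) = 1 := by simp
    rw [h0] at hsplit
    rw [← hsplit, ← mul_assoc, ← Real.exp_add, neg_add_cancel, Real.exp_zero, one_mul]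

/-- The terms n = 0 and n = 1 have relative exponents ∓πu/t and add up to 2 cosh(πu/t). Every other
term is smaller than this sum by at least e^{-π/t}, uniformly in u. -/
lemma gaussSum_eq_half {t : ℝ} (ht : 0 < t) (ht1 : t ≤ 1) {u : ℝ} (hu : |u| ≤ 1 / 2) :
    ∃ β : ℝ, 0 ≤ β ∧ β ≤ gaussTail * Real.exp (-(Real.pi / t)) ∧
      gaussSum t (u + 1 / 2) = Real.exp (-(Real.pi * u ^ 2 / t)) * Real.exp (-(Real.pi / (4 * t))) *
        (2 * Real.cosh (Real.pi * u / t) * (1 + β)) := by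
  obtain ⟨hs, -⟩ := hasSum_gaussSum ht (u + 1 / 2)
  have hs' := hs.mul_left (Real.exp (Real.pi * u ^ 2 / t) * Real.exp (Real.pi / (4 * t)))
  have hterm : ∀ n : ℤ, Real.exp (Real.pi * u ^ 2 / t) * Real.exp (Real.pi / (4 * t)) *
      Real.exp (-(Real.pi * (u + 1 / 2 - n) ^ 2 / t)) =
      Real.exp (-(Real.pi * ((n : ℝ) ^ 2 - n + u * (1 - 2 * n)) / t)) := by
    intro n
    rw [← Real.exp_add, ← Real.exp_add]; congr 1; field_simp; ring
  simp only [hterm] at hs'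
  set f : ℤ → ℝ := fun n => Real.exp (-(Real.pi * ((n : ℝ) ^ 2 - n + u * (1 - 2 * n)) / t)) with hf
  set g : ℤ → ℝ := fun n => if n = 1 then 0 else if n = 0 then 0 else f n with hg
  have hsplit : ∑' n, f n = f 0 + (f 1 + ∑' n, g n) := by
    rw [hs'.summable.tsum_eq_add_tsum_ite 0]
    congr 1
    have h2 : Summable fun n : ℤ => if n = 0 then 0 else f n :=
      hs'.summable.of_nonneg_of_le (fun n => by split_ifs <;> positivity)
        (fun n => by split_ifs; exacts [(Real.exp_pos _).le, le_rfl])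
    rw [h2.tsum_eq_add_tsum_ite 1]
    simp [hg]
  rw [hs'.tsum_eq] at hsplit
  have hnn : ∀ n, 0 ≤ g n := by
    intro n; simp only [hg]; split_ifs <;> positivity
  set c := 2 * Real.cosh (Real.pi * u / t) with hc
  have hcabs : Real.exp (Real.pi * |u| / t) ≤ c := by
    have : c = Real.exp (|Real.pi * u / t|) + Real.exp (-|Real.pi * u / t|) := by
      rw [hc, ← Real.cosh_abs, Real.cosh_eq]; ring
    rw [this, abs_div, abs_mul, abs_of_pos Real.pi_pos, abs_of_pos ht]
    linarith [Real.exp_pos (-(Real.pi * |u| / t))]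
  have hc0 : 0 < c := (Real.exp_pos _).trans_le hcabs
  have hle : ∀ n, g n ≤ Real.exp (-(Real.pi * (|(n : ℝ)| - 2))) *
      (Real.exp (-(Real.pi / t)) * c) := by
    intro n
    simp only [hg]
    split_ifs with h1 h0
    · positivity
    · positivity
    -- The surplus vanishes exactly at n = 2 and n = -1, the nearest remaining indices on either
    -- side; it is at least |n| - 2, which explains the 2 in `gaussTail`.
    · have hk : 0 ≤ (|2 * (n : ℝ) - 1| - 3) / 2 ∧ 1 - |u| + (|2 * (n : ℝ) - 1| - 3) / 2 ≤
          (n : ℝ) ^ 2 - n + u * (1 - 2 * n) ∧ |(n : ℝ)| - 2 ≤ (|2 * (n : ℝ) - 1| - 3) / 2 := by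
        have hu1 := abs_le.mp hu
        have hu2 := neg_abs_le u
        have hu3 := le_abs_self u
        rcases (show 2 ≤ n ∨ n ≤ -1 by omega) with h | h
        · have h' : (2 : ℝ) ≤ n := by exact_mod_cast h
          rw [abs_of_nonneg (by linarith : (0 : ℝ) ≤ 2 * n - 1),
            abs_of_nonneg (by linarith : (0 : ℝ) ≤ (n : ℝ))]
          refine ⟨by linarith, ?_, by linarith⟩
          nlinarith [mul_nonneg (by linarith : (0 : ℝ) ≤ 2 * n - 1) (sub_nonneg.mpr hu3),
            mul_nonneg (by linarith : (0 : ℝ) ≤ n - 2) (sub_nonneg.mpr hu)]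
        · have h' : (n : ℝ) ≤ -1 := by exact_mod_cast h
          rw [abs_of_nonpos (by linarith : 2 * (n : ℝ) - 1 ≤ 0),
            abs_of_nonpos (by linarith : (n : ℝ) ≤ 0)]
          refine ⟨by linarith, ?_, by linarith⟩
          nlinarith [mul_nonneg (by linarith : (0 : ℝ) ≤ 1 - 2 * n) (by linarith : 0 ≤ u + |u|),
            mul_nonneg (by linarith : (0 : ℝ) ≤ -1 - n) (sub_nonneg.mpr hu)]
      refine (exp_neg_div_le ht ht1 hk.1 hk.2.1).trans ?_
      rw [mul_comm]
      refine mul_le_mul ?_ ?_ (Real.exp_pos _).le (Real.exp_pos _).le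
      · rw [Real.exp_le_exp, neg_le_neg_iff]
        exact mul_le_mul_of_nonneg_left hk.2.2 Real.pi_pos.le
      · rw [show -(Real.pi * (1 - |u|) / t) = -(Real.pi / t) + Real.pi * |u| / t by ring,
          Real.exp_add]
        gcongr
  have hsum := (summable_exp_neg_pi_mul_abs_sub 2).mul_right (Real.exp (-(Real.pi / t)) * c)
  have hgle : ∑' n, g n ≤ gaussTail * (Real.exp (-(Real.pi / t)) * c) := by
    rw [gaussTail, ← tsum_mul_right]
    exact (Summable.of_nonneg_of_le hnn hle hsum).tsum_le_tsum hle hsum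
  refine ⟨(∑' n, g n) / c, div_nonneg (tsum_nonneg hnn) hc0.le, ?_, ?_⟩
  · rw [div_le_iff₀ hc0, mul_assoc]; exact hgle
  · have h01 : f 0 + f 1 = c := by
      rw [hc, Real.cosh_eq, hf]
      simp only [Int.cast_zero, Int.cast_one]
      rw [add_comm, mul_div_cancel₀ _ (two_ne_zero)]
      congr 2 <;> ring
    rw [← add_assoc, h01] at hsplit
    rw [mul_add, mul_one, mul_div_cancel₀ _ hc0.ne', ← hsplit, ← mul_assoc, ← Real.exp_add,
      ← Real.exp_add, ← Real.exp_add]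
    rw [show -(Real.pi * u ^ 2 / t) + -(Real.pi / (4 * t)) +
      (Real.pi * u ^ 2 / t + Real.pi / (4 * t)) = 0 by ring, Real.exp_zero, one_mul]

lemma inv_cosh_le (x : ℝ) : (Real.cosh x)⁻¹ ≤ 2 * Real.exp (-|x|) := by
  rw [← Real.cosh_abs, inv_le_comm₀ (Real.cosh_pos _) (by positivity), mul_inv, ← Real.exp_neg,
    neg_neg, Real.cosh_eq]
  linarith [Real.exp_pos (-|x|)]

lemma inv_cosh_le_one (x : ℝ) : (Real.cosh x)⁻¹ ≤ 1 := inv_le_one_of_one_le₀ (Real.one_le_cosh x)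

lemma inv_cosh_pos (x : ℝ) : 0 < (Real.cosh x)⁻¹ := inv_pos.mpr (Real.cosh_pos x)

/-- Uniform approximation of the generating function by a power of the hyperbolic secant. -/
lemma exists_gaussSum_quotient_bound {m : ℕ} (hm : 1 < m) :
    ∃ C : ℝ, 0 ≤ C ∧ ∀ t : ℝ, 0 < t → t ≤ 1 → ∀ u : ℝ, |u| ≤ 1 / 2 →
      |(gaussSum t u / gaussSum t (u + 1 / 2)) ^ m * (2 * Real.exp (-(Real.pi / (4 * t)))) ^ m -
        (Real.cosh (Real.pi * u / t))⁻¹ ^ m| ≤ C * Real.exp (-(Real.pi / t)) := by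
  -- The first factors are a Lipschitz constant for y ↦ y^m on [0, 1 + gaussTail]; 5 = 4 + 1
  -- collects the numerator error α and the denominator error β.
  refine ⟨m * (1 + gaussTail) ^ (m - 1) * (5 * gaussTail), by
    have := gaussTail_nonneg
    positivity, fun t ht ht1 u hu => ?_⟩
  obtain ⟨α, hα0, hα, hGα⟩ := gaussSum_eq_central ht ht1 hu
  obtain ⟨β, hβ0, hβ, hGβ⟩ := gaussSum_eq_half ht ht1 hu
  have hS := gaussTail_nonneg
  set s := (Real.cosh (Real.pi * u / t))⁻¹ with hs
  have hs0 : 0 < s := inv_cosh_pos _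
  have hs1 : s ≤ 1 := inv_cosh_le_one _
  set y := (1 + α) / (1 + β) with hy
  have hquot : (gaussSum t u / gaussSum t (u + 1 / 2)) ^ m *
      (2 * Real.exp (-(Real.pi / (4 * t)))) ^ m = s ^ m * y ^ m := by
    rw [← mul_pow, ← mul_pow, hGα, hGβ, hs, hy]
    congr 1
    have h1 := (Real.cosh_pos (Real.pi * u / t)).ne'
    have h2 := (Real.exp_pos (-(Real.pi * u ^ 2 / t))).ne'
    have h3 := (Real.exp_pos (-(Real.pi / (4 * t)))).ne'
    have h4 : 1 + β ≠ 0 := by positivity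
    field_simp
  have hα1 : α ≤ gaussTail := hα.trans (mul_le_of_le_one_right hS (by
    rw [Real.exp_le_one_iff, neg_nonpos]
    have : 0 ≤ 1 - 2 * |u| := by linarith
    have := Real.pi_pos
    positivity))
  have hy0 : 0 ≤ y := by positivity
  have hyS : y ≤ 1 + gaussTail := by
    rw [hy]
    exact (div_le_self (by positivity) (by linarith)).trans (by linarith)
  have hy1 : |y - 1| ≤ α + β := by
    have : y - 1 = (α - β) / (1 + β) := by rw [hy]; field_simp; ring
    rw [this, abs_div, abs_of_pos (by positivity : 0 < 1 + β)]
    refine (div_le_self (abs_nonneg _) (by linarith)).trans ?_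
    rw [abs_le]; constructor <;> linarith
  have hym : |y ^ m - 1| ≤ (α + β) * m * (1 + gaussTail) ^ (m - 1) := by
    have h := abs_pow_sub_pow_le y 1 m
    rw [one_pow, abs_one, abs_of_nonneg hy0] at h
    refine h.trans ?_
    gcongr
    exact max_le hyS (by linarith)
  -- Here m ≥ 2 is essential: s² ≤ 4 e^{-2π|u|/t} exactly compensates the loss in α ≲
  -- e^{-π(1-2|u|)/t}.
  have hsm : s ^ m ≤ s ^ 2 := pow_le_pow_of_le_one hs0.le hs1 hm
  have hs2 : s ^ 2 ≤ 4 * Real.exp (-(2 * Real.pi * |u| / t)) := by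
    have h := pow_le_pow_left₀ hs0.le (inv_cosh_le (Real.pi * u / t)) 2
    refine h.trans (le_of_eq ?_)
    rw [mul_pow, ← Real.exp_nat_mul, abs_div, abs_mul, abs_of_pos Real.pi_pos, abs_of_pos ht]
    norm_num
    ring
  have hsα : s ^ m * α ≤ 4 * gaussTail * Real.exp (-(Real.pi / t)) := by
    calc s ^ m * α ≤ (4 * Real.exp (-(2 * Real.pi * |u| / t))) *
          (gaussTail * Real.exp (-(Real.pi * (1 - 2 * |u|) / t))) :=
          mul_le_mul (hsm.trans hs2) hα hα0 (by positivity)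
      _ = 4 * gaussTail * (Real.exp (-(2 * Real.pi * |u| / t)) *
            Real.exp (-(Real.pi * (1 - 2 * |u|) / t))) := by ring
      _ = _ := by
          rw [← Real.exp_add]; congr 2; ring
  have hsβ : s ^ m * β ≤ gaussTail * Real.exp (-(Real.pi / t)) :=
    (mul_le_of_le_one_left hβ0 (pow_le_one₀ hs0.le hs1)).trans hβ
  rw [hquot, show s ^ m * y ^ m - s ^ m = s ^ m * (y ^ m - 1) by ring, abs_mul,
    abs_of_pos (by positivity : 0 < s ^ m)]
  calc s ^ m * |y ^ m - 1| ≤ s ^ m * ((α + β) * m * (1 + gaussTail) ^ (m - 1)) := by gcongr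
    _ = m * (1 + gaussTail) ^ (m - 1) * (s ^ m * α + s ^ m * β) := by ring
    _ ≤ m * (1 + gaussTail) ^ (m - 1) * (4 * gaussTail * Real.exp (-(Real.pi / t)) +
          gaussTail * Real.exp (-(Real.pi / t))) := by gcongr
    _ = _ := by ring

/-! ### Moments of powers of the hyperbolic secant: integrability, recursion, initial values -/

open MeasureTheory Filter

lemma abs_pow_mul_inv_cosh_le (k : ℕ) (v : ℝ) :
    |v| ^ k * (Real.cosh (Real.pi * v))⁻¹ ≤ 2 * k.factorial := by
  have h1 : |v| ^ k ≤ k.factorial * Real.exp |v| := by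
    have := Real.pow_div_factorial_le_exp |v| (abs_nonneg v) k
    rwa [div_le_iff₀ (by positivity), mul_comm] at this
  have h2 : (Real.cosh (Real.pi * v))⁻¹ ≤ 2 * Real.exp (-|v|) := by
    refine (inv_cosh_le _).trans ?_
    rw [abs_mul, abs_of_pos Real.pi_pos]
    have : |v| ≤ Real.pi * |v| :=
      le_mul_of_one_le_left (abs_nonneg v) (by linarith [Real.pi_gt_three])
    gcongr
  calc |v| ^ k * (Real.cosh (Real.pi * v))⁻¹
      ≤ (k.factorial * Real.exp |v|) * (2 * Real.exp (-|v|)) :=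
        mul_le_mul h1 h2 (inv_cosh_pos _).le (by positivity)
    _ = 2 * k.factorial * (Real.exp |v| * Real.exp (-|v|)) := by ring
    _ = 2 * k.factorial := by rw [← Real.exp_add]; simp

lemma inv_cosh_pow_le {n : ℕ} (hn : n ≠ 0) (x : ℝ) :
    (Real.cosh x)⁻¹ ^ n ≤ (Real.cosh x)⁻¹ :=
  pow_le_of_le_one (inv_cosh_pos _).le (inv_cosh_le_one _) hn

lemma continuous_inv_cosh : Continuous fun v : ℝ => (Real.cosh (Real.pi * v))⁻¹ :=
  Continuous.inv₀ (by fun_prop) fun _ => (Real.cosh_pos _).ne'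

lemma integrable_pow_mul_inv_cosh_pow (k : ℕ) {n : ℕ} (hn : n ≠ 0) :
    Integrable fun v : ℝ => v ^ k * (Real.cosh (Real.pi * v))⁻¹ ^ n := by
  refine (integrable_inv_one_add_sq.const_mul
    (2 * k.factorial + 2 * (k + 2).factorial : ℝ)).mono'
    ((by fun_prop : Continuous fun v : ℝ => v ^ k).mul
      (continuous_inv_cosh.pow n)).aestronglyMeasurable (ae_of_all _ fun v => ?_)
  rw [Real.norm_eq_abs, abs_mul, abs_pow, abs_of_pos (pow_pos (inv_cosh_pos _) n),
    ← div_eq_mul_inv, le_div_iff₀ (by positivity)]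
  calc |v| ^ k * (Real.cosh (Real.pi * v))⁻¹ ^ n * (1 + v ^ 2)
      ≤ |v| ^ k * (Real.cosh (Real.pi * v))⁻¹ * (1 + v ^ 2) := by
        gcongr
        exact inv_cosh_pow_le hn _
    _ = |v| ^ k * (Real.cosh (Real.pi * v))⁻¹ + |v| ^ (k + 2) * (Real.cosh (Real.pi * v))⁻¹ := by
        rw [← sq_abs v]; ring
    _ ≤ _ := add_le_add (abs_pow_mul_inv_cosh_le _ _) (abs_pow_mul_inv_cosh_le _ _)

/-- The moments `∫ v^k / cosh^n (π v) dv`. -/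
def sechMoment (k n : ℕ) : ℝ := ∫ v : ℝ, v ^ k * (Real.cosh (Real.pi * v))⁻¹ ^ n

lemma hasDerivAt_inv_cosh_pow (n : ℕ) (v : ℝ) :
    HasDerivAt (fun v : ℝ => (Real.cosh (Real.pi * v))⁻¹ ^ n)
      (-(n * Real.pi * (Real.sinh (Real.pi * v) * (Real.cosh (Real.pi * v))⁻¹ ^ (n + 1)))) v := by
  have h1 : HasDerivAt (fun v : ℝ => Real.pi * v) Real.pi v := by
    simpa using (hasDerivAt_id v).const_mul Real.pi
  have h := (h1.cosh.inv (Real.cosh_pos _).ne').pow n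
  refine h.congr_deriv ?_
  have := (Real.cosh_pos (Real.pi * v)).ne'
  rcases n with _ | n
  · simp
  · push_cast
    simp only [Pi.inv_apply, inv_pow]
    field_simp
    ring

lemma hasDerivAt_sinh_mul_inv_cosh_pow (n : ℕ) (v : ℝ) :
    HasDerivAt (fun v : ℝ => Real.sinh (Real.pi * v) * (Real.cosh (Real.pi * v))⁻¹ ^ (n + 1))
      (Real.pi * ((n + 1) * (Real.cosh (Real.pi * v))⁻¹ ^ (n + 2) -
        n * (Real.cosh (Real.pi * v))⁻¹ ^ n)) v := by
  have h1 : HasDerivAt (fun v : ℝ => Real.pi * v) Real.pi v := by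
    simpa using (hasDerivAt_id v).const_mul Real.pi
  have h := h1.sinh.mul (hasDerivAt_inv_cosh_pow (n + 1) v)
  refine h.congr_deriv ?_
  have hc := (Real.cosh_pos (Real.pi * v)).ne'
  have hs : Real.sinh (Real.pi * v) ^ 2 = Real.cosh (Real.pi * v) ^ 2 - 1 := Real.sinh_sq _
  have hx : Real.cosh (Real.pi * v) * (Real.cosh (Real.pi * v))⁻¹ = 1 := mul_inv_cancel₀ hc
  push_cast
  set c := Real.cosh (Real.pi * v)
  set x := c⁻¹
  linear_combination (-(n + 1) * Real.pi * x ^ (n + 2)) * hs -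
    Real.pi * x ^ n * ((n + 1) * c * x + n) * hx

lemma integrable_pow_mul_sinh_mul_inv_cosh_pow (k : ℕ) {n : ℕ} (hn : n ≠ 0) :
    Integrable fun v : ℝ =>
      v ^ k * (Real.sinh (Real.pi * v) * (Real.cosh (Real.pi * v))⁻¹ ^ (n + 1)) := by
  refine (integrable_pow_mul_inv_cosh_pow k hn).mono
    ((by fun_prop : Continuous fun v : ℝ => v ^ k).mul ((by fun_prop : Continuous fun v : ℝ =>
      Real.sinh (Real.pi * v)).mul (continuous_inv_cosh.pow _))).aestronglyMeasurable
    (ae_of_all _ fun v => ?_)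
  rw [norm_mul, norm_mul (v ^ k)]
  refine mul_le_mul_of_nonneg_left ?_ (norm_nonneg _)
  rw [norm_mul, pow_succ', norm_mul, ← mul_assoc]
  refine mul_le_of_le_one_left (norm_nonneg _) ?_
  rw [← norm_mul, Real.norm_eq_abs, abs_mul, abs_inv, abs_of_pos (Real.cosh_pos _),
    ← div_eq_mul_inv, div_le_one (Real.cosh_pos _)]
  refine abs_le_of_sq_le_sq ?_ (Real.cosh_pos _).le
  rw [Real.cosh_sq]
  linarith

/-- With s = sech(πv), the Wronskian W = (v^k)' s^n - v^k (s^n)' is integrable and W' = (v^k)'' s^n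
- v^k (s^n)'' has integral zero, where (s^n)'' = π²(n² s^n - n(n+1) s^{n+2}). -/
lemma sechMoment_recursion (k : ℕ) {n : ℕ} (hn : n ≠ 0) :
    Real.pi ^ 2 * (n * (n + 1)) * sechMoment k (n + 2) =
      Real.pi ^ 2 * n ^ 2 * sechMoment k n - k * (k - 1) * sechMoment (k - 2) n := by
  set s : ℝ → ℕ → ℝ := fun v j => (Real.cosh (Real.pi * v))⁻¹ ^ j with hs
  set W : ℝ → ℝ := fun v => n * Real.pi * (v ^ k * (Real.sinh (Real.pi * v) * s v (n + 1))) +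
    k * (v ^ (k - 1) * s v n) with hW
  set W' : ℝ → ℝ := fun v => Real.pi ^ 2 * (n * (n + 1)) * (v ^ k * s v (n + 2)) -
    Real.pi ^ 2 * n ^ 2 * (v ^ k * s v n) + k * (k - 1) * (v ^ (k - 2) * s v n) with hW'
  have i1 := (integrable_pow_mul_inv_cosh_pow k (n := n + 2) (by omega)).const_mul
    (Real.pi ^ 2 * (n * (n + 1)))
  have i2 := (integrable_pow_mul_inv_cosh_pow k hn).const_mul (Real.pi ^ 2 * n ^ 2)
  have i3 := (integrable_pow_mul_inv_cosh_pow (k - 2) hn).const_mul ((k : ℝ) * (k - 1))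
  have hder : ∀ v, HasDerivAt W (W' v) v := by
    intro v
    have h1 := ((hasDerivAt_pow k v).mul (hasDerivAt_sinh_mul_inv_cosh_pow n v)).const_mul
      (n * Real.pi)
    have h2 := ((hasDerivAt_pow (k - 1) v).mul (hasDerivAt_inv_cosh_pow n v)).const_mul (k : ℝ)
    refine (h1.add h2).congr_deriv ?_
    -- The truncated subtractions are harmless: for k < 2 the coefficient k(k - 1) vanishes.
    have hk : (k : ℝ) * (k - 1 : ℕ) = k * (k - 1) := by
      rcases k with _ | k <;> simp
    rw [show k - 1 - 1 = k - 2 by omega]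
    simp only [hW', hs]
    linear_combination (v ^ (k - 2) * (Real.cosh (Real.pi * v))⁻¹ ^ n) * hk
  have hint' : Integrable W' := (i1.sub i2).add i3
  have hint : Integrable W := ((integrable_pow_mul_sinh_mul_inv_cosh_pow k hn).const_mul _).add
    ((integrable_pow_mul_inv_cosh_pow (k - 1) hn).const_mul _)
  have h := integral_eq_zero_of_hasDerivAt_of_integrable hder hint' hint
  have e1 := integral_add (i1.sub i2) i3
  have e2 := integral_sub i1 i2
  simp only [Pi.sub_apply] at e1
  rw [e2, integral_const_mul, integral_const_mul, integral_const_mul] at e1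
  simp only [sechMoment]
  linear_combination h - e1

lemma sechMoment_zero_one : sechMoment 0 1 = 1 := by
  have hder : ∀ v : ℝ, HasDerivAt (fun v => Real.pi⁻¹ * Real.arctan (Real.sinh (Real.pi * v)))
      (v ^ 0 * (Real.cosh (Real.pi * v))⁻¹ ^ 1) v := by
    intro v
    have h1 : HasDerivAt (fun v : ℝ => Real.pi * v) Real.pi v := by
      simpa using (hasDerivAt_id v).const_mul Real.pi
    refine (h1.sinh.arctan.const_mul Real.pi⁻¹).congr_deriv ?_
    rw [add_comm, ← Real.cosh_sq]
    have := (Real.cosh_pos (Real.pi * v)).ne'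
    have := Real.pi_pos.ne'
    field_simp
  have hpi : Tendsto (fun v : ℝ => Real.pi * v) atTop atTop :=
    tendsto_id.const_mul_atTop Real.pi_pos
  have hpi' : Tendsto (fun v : ℝ => Real.pi * v) atBot atBot :=
    tendsto_id.const_mul_atBot Real.pi_pos
  have hsinh : Tendsto Real.sinh atTop atTop :=
    tendsto_atTop_mono' _ (by
      filter_upwards [eventually_ge_atTop 0] with x hx using Real.self_le_sinh_iff.mpr hx) tendsto_id
  have hsinh' : Tendsto Real.sinh atBot atBot :=
    tendsto_atBot_mono' _ (by
      filter_upwards [eventually_le_atBot 0] with x hx using Real.sinh_le_self_iff.mpr hx) tendsto_id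
  have htop := (((tendsto_nhds_of_tendsto_nhdsWithin Real.tendsto_arctan_atTop).comp
    (hsinh.comp hpi))).const_mul Real.pi⁻¹
  have hbot := (((tendsto_nhds_of_tendsto_nhdsWithin Real.tendsto_arctan_atBot).comp
    (hsinh'.comp hpi'))).const_mul Real.pi⁻¹
  rw [sechMoment, integral_of_hasDerivAt_of_tendsto hder
    (integrable_pow_mul_inv_cosh_pow 0 one_ne_zero) hbot htop]
  have := Real.pi_pos.ne'
  field_simp
  norm_num

lemma sechMoment_zero_two : sechMoment 0 2 = 2 / Real.pi := by
  -- The antiderivative is tanh(πv)/π up to a constant, in logistic form so that its limits follow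
  -- from those of exp.
  have hder : ∀ v : ℝ, HasDerivAt
      (fun v => -(2 / Real.pi) * (Real.exp (2 * Real.pi * v) + 1)⁻¹)
      (v ^ 0 * (Real.cosh (Real.pi * v))⁻¹ ^ 2) v := by
    intro v
    have h1 : HasDerivAt (fun v : ℝ => 2 * Real.pi * v) (2 * Real.pi) v := by
      simpa using (hasDerivAt_id v).const_mul (2 * Real.pi)
    have hne : Real.exp (2 * Real.pi * v) + 1 ≠ 0 := by positivity
    refine (((h1.exp.add_const 1).inv hne).const_mul (-(2 / Real.pi))).congr_deriv ?_
    have e : Real.exp (2 * Real.pi * v) = Real.exp (Real.pi * v) ^ 2 := by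
      rw [← Real.exp_nat_mul]; congr 1; push_cast; ring
    have hp := Real.exp_pos (Real.pi * v)
    have hpi := Real.pi_pos.ne'
    rw [Real.cosh_eq, Real.exp_neg, e]
    rw [e] at hne
    field_simp
  have hpi : Tendsto (fun v : ℝ => 2 * Real.pi * v) atTop atTop :=
    tendsto_id.const_mul_atTop (by positivity)
  have hpi' : Tendsto (fun v : ℝ => 2 * Real.pi * v) atBot atBot :=
    tendsto_id.const_mul_atBot (by positivity)
  have htop : Tendsto (fun v => -(2 / Real.pi) * (Real.exp (2 * Real.pi * v) + 1)⁻¹) atTop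
      (𝓝 (-(2 / Real.pi) * 0)) :=
    ((tendsto_inv_atTop_zero.comp
      (tendsto_atTop_add_const_right _ 1 (Real.tendsto_exp_atTop.comp hpi))).const_mul _)
  have hbot : Tendsto (fun v => -(2 / Real.pi) * (Real.exp (2 * Real.pi * v) + 1)⁻¹) atBot
      (𝓝 (-(2 / Real.pi) * (0 + 1)⁻¹)) :=
    (((Real.tendsto_exp_atBot.comp hpi').add_const 1).inv₀ (by norm_num)).const_mul _
  rw [sechMoment, integral_of_hasDerivAt_of_tendsto hder
    (integrable_pow_mul_inv_cosh_pow 0 two_ne_zero) hbot htop]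
  norm_num

/-! ### Contour shift for w^k / sinh^n(πw) -/

open Complex in
/-- Shifting the contour across the strip `|Im w| ≤ 1/2`. -/
lemma integral_shift_strip {g : ℂ → ℂ} (hg : DifferentiableOn ℂ g {w | |w.im| < 1})
    (hint₁ : Integrable fun x : ℝ => g (x + (1 / 2 : ℝ) * I))
    (hint₂ : Integrable fun x : ℝ => g (x + (-(1 / 2) : ℝ) * I)) {b : ℝ → ℝ}
    (hb : Tendsto b atTop (𝓝 0))
    (hgb : ∀ x : ℝ, x ≠ 0 → ∀ y : ℝ, |y| ≤ 1 / 2 → ‖g (x + y * I)‖ ≤ b |x|) :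
    ∫ x : ℝ, g (x + (1 / 2 : ℝ) * I) = ∫ x : ℝ, g (x + (-(1 / 2) : ℝ) * I) := by
  have hrect : ∀ T : ℝ, 0 < T →
      ‖(∫ x in -T..T, g (x + (-(1 / 2) : ℝ) * I)) - ∫ x in -T..T, g (x + (1 / 2 : ℝ) * I)‖ ≤
        2 * b T := by
    intro T hT
    have h := integral_boundary_rect_eq_zero_of_differentiableOn g
      ((-T : ℝ) + (-(1 / 2) : ℝ) * I) ((T : ℝ) + (1 / 2 : ℝ) * I) (hg.mono ?_)
    · simp only [ofReal_re, ofReal_im, add_re, add_im, mul_re, mul_im, I_re, I_im, mul_zero,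
        mul_one, sub_zero, zero_add, add_zero] at h
      have side : ∀ s : ℝ, |s| = T →
          ‖∫ y : ℝ in (-(1 / 2))..(1 / 2), g (s + y * I)‖ ≤ b T := by
        intro s hs
        refine (intervalIntegral.norm_integral_le_of_norm_le_const (C := b T)
          fun y hy => ?_).trans (by norm_num)
        rw [Set.uIoc_of_le (by norm_num)] at hy
        have hs0 : s ≠ 0 := by rintro rfl; simp at hs; linarith
        rw [← hs]
        exact hgb s hs0 y (abs_le.mpr ⟨hy.1.le, hy.2⟩)
      have e : (∫ x in -T..T, g (x + (-(1 / 2) : ℝ) * I)) - ∫ x in -T..T, g (x + (1 / 2 : ℝ) * I) =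
          I • (∫ y : ℝ in (-(1 / 2))..(1 / 2), g ((-T : ℝ) + y * I)) -
          I • (∫ y : ℝ in (-(1 / 2))..(1 / 2), g (T + y * I)) := by
        linear_combination h
      rw [e]
      refine (norm_sub_le _ _).trans ?_
      rw [norm_smul, norm_smul, norm_I, one_mul, one_mul]
      linarith [side (-T) (by rw [abs_neg, abs_of_pos hT]), side T (abs_of_pos hT)]
    · rintro z hz
      have hz2 := hz.2
      simp only [Set.mem_preimage, ofReal_im, add_im, mul_im, ofReal_re, I_im, I_re, mul_one,
        mul_zero, add_zero, zero_add] at hz2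
      rw [Set.uIcc_of_le (by norm_num)] at hz2
      simp only [Set.mem_ofPred_eq]
      rw [abs_lt]
      constructor <;> linarith [hz2.1, hz2.2]
  have h1 := (intervalIntegral_tendsto_integral hint₂ tendsto_neg_atTop_atBot tendsto_id).sub
    (intervalIntegral_tendsto_integral hint₁ tendsto_neg_atTop_atBot tendsto_id)
  have h2 : Tendsto (fun T : ℝ => (∫ x in -T..T, g (x + (-(1 / 2) : ℝ) * I)) -
      ∫ x in -T..T, g (x + (1 / 2 : ℝ) * I)) atTop (𝓝 0) := by
    refine squeeze_zero_norm' ?_ (by simpa using hb.const_mul 2)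
    filter_upwards [eventually_gt_atTop 0] with T hT using hrect T hT
  exact (sub_eq_zero.mp (tendsto_nhds_unique h1 h2)).symm

open Complex in
lemma abs_sinh_le_norm_sinh (x y : ℝ) : |Real.sinh x| ≤ ‖sinh (x + y * I)‖ := by
  have h1 : ‖exp (x + y * I)‖ = Real.exp x := by rw [norm_exp]; simp
  have h2 : ‖exp (-(x + y * I))‖ = Real.exp (-x) := by rw [norm_exp]; simp
  rw [Complex.sinh, Real.sinh_eq, norm_div, abs_div, Complex.norm_two, abs_two]
  have := abs_norm_sub_norm_le (exp (x + y * I)) (exp (-(x + y * I)))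
  rw [h1, h2] at this
  gcongr

open Complex in
lemma sinh_pi_mul_ne_zero {w : ℂ} (hw : |w.im| < 1) (h0 : w ≠ 0) : sinh (Real.pi * w) ≠ 0 := by
  have hw' : Real.pi * w = (Real.pi * w.re : ℝ) + (Real.pi * w.im : ℝ) * I := by
    conv_lhs => rw [← re_add_im w]
    push_cast; ring
  by_cases hre : w.re = 0
  · have him : w.im ≠ 0 := fun h => h0 (Complex.ext hre h)
    rw [hw', hre, mul_zero, ofReal_zero, zero_add, sinh_mul_I, ← ofReal_sin]
    refine mul_ne_zero (ofReal_ne_zero.mpr ?_) I_ne_zero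
    rw [abs_lt] at hw
    have hpi := Real.pi_pos
    refine fun hs => him ?_
    have := (Real.sin_eq_zero_iff_of_lt_of_lt (x := Real.pi * w.im) (by nlinarith)
      (by nlinarith)).mp hs
    exact (mul_eq_zero.mp this).resolve_left hpi.ne'
  · intro h
    have := abs_sinh_le_norm_sinh (Real.pi * w.re) (Real.pi * w.im)
    rw [← hw', h, norm_zero] at this
    have h2 := Real.sinh_eq_zero.mp (abs_nonpos_iff.mp this)
    exact hre ((mul_eq_zero.mp h2).resolve_left Real.pi_pos.ne')

open Complex in
/-- `w ^ (j + n) / sinh (π w) ^ n` extends holomorphically to the strip `|Im w| < 1`. -/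
lemma exists_differentiableOn_pow_div_sinh (j n : ℕ) :
    ∃ g : ℂ → ℂ, DifferentiableOn ℂ g {w | |w.im| < 1} ∧
      ∀ w, w ≠ 0 → g w = w ^ (j + n) / sinh (Real.pi * w) ^ n := by
  set f : ℂ → ℂ := fun w => sinh (Real.pi * w) with hf
  have hfd : Differentiable ℂ f := by fun_prop
  have hfd' : Differentiable ℂ (dslope f 0) := by
    rw [← differentiableOn_univ, Complex.differentiableOn_dslope Filter.univ_mem]
    exact hfd.differentiableOn
  have hne : ∀ w : ℂ, w ≠ 0 → dslope f 0 w = sinh (Real.pi * w) / w := by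
    intro w hw
    rw [dslope_of_ne _ hw, slope_def_field]
    simp [hf]
  have h0 : dslope f 0 0 = Real.pi := by
    rw [dslope_same]
    have h : HasDerivAt (fun w : ℂ => (Real.pi : ℂ) * w) Real.pi 0 := by
      simpa using (hasDerivAt_id (0 : ℂ)).const_mul (Real.pi : ℂ)
    simpa using h.csinh.deriv
  -- The slope `dslope f 0` is sinh(πw)/w, continued by π at 0, and has no zeros in the strip.
  refine ⟨fun w => w ^ j * (dslope f 0 w)⁻¹ ^ n, ?_, fun w hw => ?_⟩
  · refine (differentiable_pow j).differentiableOn.mul ((hfd'.differentiableOn.inv ?_).pow n)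
    intro w hw
    by_cases h : w = 0
    · rw [h, h0]; exact_mod_cast Real.pi_pos.ne'
    · rw [hne w h]; exact div_ne_zero (sinh_pi_mul_ne_zero hw h) h
  · simp only [hne w hw, inv_div, div_pow, pow_add]
    ring

lemma tendsto_pow_div_sinh (k : ℕ) {n : ℕ} (hn : n ≠ 0) :
    Tendsto (fun x : ℝ => (x + 1) ^ k / Real.sinh (Real.pi * x) ^ n) atTop (𝓝 0) := by
  have h1 := ((Real.tendsto_pow_mul_exp_neg_atTop_nhds_zero k).comp
    (tendsto_atTop_add_const_right _ (1 : ℝ) tendsto_id)).const_mul (4 * Real.exp 1)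
  rw [mul_zero] at h1
  refine squeeze_zero' ?_ ?_ h1
  · filter_upwards [eventually_ge_atTop 0] with x hx
    have : 0 ≤ Real.sinh (Real.pi * x) :=
      Real.sinh_nonneg_iff.mpr (mul_nonneg Real.pi_pos.le hx)
    positivity
  · filter_upwards [eventually_ge_atTop 1] with x hx
    have hpx : x ≤ Real.pi * x := le_mul_of_one_le_left (by linarith) (by linarith [Real.pi_gt_three])
    have hs1 : x ≤ Real.sinh x := Real.self_le_sinh_iff.mpr (by linarith)
    have hs2 : Real.exp x / 4 ≤ Real.sinh x := by
      have : 2 * Real.exp (-x) ≤ Real.exp x := by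
        have h2 : Real.exp (-x) ≤ 1 := by rw [Real.exp_le_one_iff]; linarith
        have h3 := Real.add_one_le_exp x
        linarith
      rw [Real.sinh_eq]; linarith
    have hs3 : Real.sinh x ≤ Real.sinh (Real.pi * x) := Real.sinh_le_sinh.mpr hpx
    have hs4 : Real.exp x / 4 ≤ Real.sinh (Real.pi * x) ^ n :=
      (hs2.trans hs3).trans (le_self_pow₀ (by linarith) hn)
    have he := Real.exp_pos x
    calc (x + 1) ^ k / Real.sinh (Real.pi * x) ^ n ≤ (x + 1) ^ k / (Real.exp x / 4) := by gcongr
      _ = 4 * Real.exp 1 * ((x + 1) ^ k * Real.exp (-(x + 1))) := by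
        rw [neg_add, Real.exp_add, Real.exp_neg, Real.exp_neg]
        field_simp

open Complex in
lemma integrable_add_pow_mul_inv_cosh_pow (c : ℂ) (k : ℕ) {n : ℕ} (hn : n ≠ 0) :
    Integrable fun v : ℝ => ((v : ℂ) + c) ^ k * (((Real.cosh (Real.pi * v))⁻¹ ^ n : ℝ) : ℂ) := by
  simp only [add_pow, Finset.sum_mul]
  refine integrable_finsetSum _ fun a _ => ?_
  refine (((integrable_pow_mul_inv_cosh_pow a hn).ofReal (𝕜 := ℂ)).mul_const
    (c ^ (k - a) * (k.choose a))).congr (ae_of_all _ fun v => ?_)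
  simp only [coe_algebraMap, ofReal_mul, ofReal_pow]
  ring

open Complex in
lemma integral_add_pow_mul_inv_cosh_pow (c : ℂ) (k : ℕ) {n : ℕ} (hn : n ≠ 0) :
    ∫ v : ℝ, ((v : ℂ) + c) ^ k * (((Real.cosh (Real.pi * v))⁻¹ ^ n : ℝ) : ℂ) =
      ∑ a ∈ Finset.range (k + 1), (sechMoment a n : ℂ) * (c ^ (k - a) * (k.choose a)) := by
  have hterm : ∀ a, (fun v : ℝ => (v : ℂ) ^ a * c ^ (k - a) * (k.choose a) *
      (((Real.cosh (Real.pi * v))⁻¹ ^ n : ℝ) : ℂ)) = fun v : ℝ =>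
      ((v ^ a * (Real.cosh (Real.pi * v))⁻¹ ^ n : ℝ) : ℂ) * (c ^ (k - a) * (k.choose a)) := by
    intro a; ext v; push_cast; ring
  simp only [add_pow, Finset.sum_mul]
  rw [integral_finsetSum]
  · refine Finset.sum_congr rfl fun a _ => ?_
    rw [hterm, integral_mul_const, integral_complex_ofReal, sechMoment]
  · intro a _
    rw [hterm]
    exact ((integrable_pow_mul_inv_cosh_pow a hn).ofReal (𝕜 := ℂ)).mul_const _

-- On the lines Im w = ±1/2 one has sinh(πw) = ±i cosh(πv), so both sides are, up to powers of ±i,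
-- integrals of w^k / sinh^n(πw). The condition n ≤ k removes the pole at 0, and (-1)^n is the ratio
-- of i^n to (-i)^n.
open Complex in
lemma integral_add_half_I_pow {k n : ℕ} (hn : n ≠ 0) (hk : n ≤ k) :
    ∫ v : ℝ, ((v : ℂ) + I / 2) ^ k * (((Real.cosh (Real.pi * v))⁻¹ ^ n : ℝ) : ℂ) =
      (-1) ^ n *
        ∫ v : ℝ, ((v : ℂ) + -(I / 2)) ^ k * (((Real.cosh (Real.pi * v))⁻¹ ^ n : ℝ) : ℂ) := by
  obtain ⟨g, hg, hgw⟩ := exists_differentiableOn_pow_div_sinh (k - n) n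
  rw [Nat.sub_add_cancel hk] at hgw
  have hne : ∀ (v y : ℝ), y ≠ 0 → (v : ℂ) + y * I ≠ 0 := by
    intro v y hy h
    have := congrArg Complex.im h
    simp at this
    exact hy this
  have hpi2 : (Real.pi : ℂ) / 2 = ((Real.pi / 2 : ℝ) : ℂ) := by push_cast; ring
  have hplus : (fun v : ℝ => g (v + (1 / 2 : ℝ) * I)) = fun v : ℝ => (I ^ n)⁻¹ *
      (((v : ℂ) + I / 2) ^ k * (((Real.cosh (Real.pi * v))⁻¹ ^ n : ℝ) : ℂ)) := by
    ext v
    have e : sinh ((Real.pi : ℂ) * (v + (1 / 2 : ℝ) * I)) = I * cosh (Real.pi * v) := by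
      rw [show (Real.pi : ℂ) * (v + (1 / 2 : ℝ) * I) =
        Real.pi * v + ((Real.pi / 2 : ℝ) : ℂ) * I by push_cast; ring, sinh_add, cosh_mul_I,
        sinh_mul_I, ← ofReal_cos, ← ofReal_sin, Real.cos_pi_div_two, Real.sin_pi_div_two]
      push_cast; ring
    rw [hgw _ (hne v _ (by norm_num)), e]
    push_cast
    rw [mul_pow, inv_pow, div_eq_mul_inv, mul_inv, show (1 : ℂ) / 2 * I = I / 2 by ring]
    ring
  have hminus : (fun v : ℝ => g (v + (-(1 / 2) : ℝ) * I)) = fun v : ℝ => ((-I) ^ n)⁻¹ *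
      (((v : ℂ) + -(I / 2)) ^ k * (((Real.cosh (Real.pi * v))⁻¹ ^ n : ℝ) : ℂ)) := by
    ext v
    have e : sinh ((Real.pi : ℂ) * (v + (-(1 / 2) : ℝ) * I)) = -I * cosh (Real.pi * v) := by
      rw [show (Real.pi : ℂ) * (v + (-(1 / 2) : ℝ) * I) =
        Real.pi * v - ((Real.pi / 2 : ℝ) : ℂ) * I by push_cast; ring, sinh_sub, cosh_mul_I,
        sinh_mul_I, ← ofReal_cos, ← ofReal_sin, Real.cos_pi_div_two, Real.sin_pi_div_two]
      push_cast; ring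
    rw [hgw _ (hne v _ (by norm_num)), e]
    push_cast
    rw [mul_pow, inv_pow, div_eq_mul_inv, mul_inv, show -((1 : ℂ) / 2) * I = -(I / 2) by ring]
    ring
  have key := integral_shift_strip hg
    (by rw [hplus]; exact (integrable_add_pow_mul_inv_cosh_pow _ k hn).const_mul _)
    (by rw [hminus]; exact (integrable_add_pow_mul_inv_cosh_pow _ k hn).const_mul _)
    (tendsto_pow_div_sinh k hn) (by
      intro x hx y hy
      have hxy : (x : ℂ) + y * I ≠ 0 := by
        intro h
        have := congrArg Complex.re h
        simp at this
        exact hx this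
      rw [hgw _ hxy, norm_div, norm_pow, norm_pow]
      have hs : Real.sinh (Real.pi * |x|) ≤ ‖sinh ((Real.pi : ℂ) * (x + y * I))‖ := by
        have := abs_sinh_le_norm_sinh (Real.pi * x) (Real.pi * y)
        rw [Real.abs_sinh, abs_mul, abs_of_pos Real.pi_pos] at this
        refine this.trans (le_of_eq ?_)
        congr 2; push_cast; ring
      have hs0 : 0 < Real.sinh (Real.pi * |x|) :=
        Real.sinh_pos_iff.mpr (mul_pos Real.pi_pos (abs_pos.mpr hx))
      have hn1 : ‖(x : ℂ) + y * I‖ ≤ |x| + 1 := by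
        refine (norm_add_le _ _).trans ?_
        rw [norm_mul, norm_I, mul_one, norm_real, norm_real, Real.norm_eq_abs, Real.norm_eq_abs]
        linarith
      gcongr)
  rw [hplus, hminus, integral_const_mul, integral_const_mul, neg_pow, mul_inv] at key
  have hI : (I ^ n : ℂ) ≠ 0 := pow_ne_zero _ I_ne_zero
  have hsq : ((-1 : ℂ) ^ n)⁻¹ = (-1) ^ n := by
    rw [← inv_pow]; norm_num
  rw [hsq] at key
  exact mul_left_cancel₀ (inv_ne_zero hI) (key.trans (by ring))

/-! ### Generating series of the moments and the higher Euler numbers -/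

/-- The exponential generating series of the moments `sechMoment k n`. -/
def sechSeries (n : ℕ) : PowerSeries ℂ :=
  PowerSeries.mk fun k => (sechMoment k n : ℂ) / (k.factorial : ℂ)

lemma coeff_rescale_exp (c : ℂ) (k : ℕ) :
    PowerSeries.coeff k (PowerSeries.rescale c (PowerSeries.exp ℂ)) = c ^ k / (k.factorial : ℂ) := by
  rw [PowerSeries.coeff_rescale, PowerSeries.coeff_exp]
  simp [div_eq_mul_inv]

lemma coeff_sechSeries_mul_rescale_exp {n : ℕ} (hn : n ≠ 0) (c : ℂ) (k : ℕ) :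
    PowerSeries.coeff k (sechSeries n * PowerSeries.rescale c (PowerSeries.exp ℂ)) =
      (∫ v : ℝ, ((v : ℂ) + c) ^ k * (((Real.cosh (Real.pi * v))⁻¹ ^ n : ℝ) : ℂ)) /
        (k.factorial : ℂ) := by
  rw [integral_add_pow_mul_inv_cosh_pow c k hn, PowerSeries.coeff_mul,
    Finset.Nat.sum_antidiagonal_eq_sum_range_succ_mk, Finset.sum_div]
  refine Finset.sum_congr rfl fun a ha => ?_
  have hak : a ≤ k := Nat.lt_succ_iff.mp (Finset.mem_range.mp ha)
  rw [coeff_rescale_exp, sechSeries, PowerSeries.coeff_mk, Nat.cast_choose ℂ hak]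
  have h1 : (a.factorial : ℂ) ≠ 0 := by exact_mod_cast a.factorial_ne_zero
  have h2 : ((k - a).factorial : ℂ) ≠ 0 := by exact_mod_cast (k - a).factorial_ne_zero
  have h3 : (k.factorial : ℂ) ≠ 0 := by exact_mod_cast k.factorial_ne_zero
  field_simp

lemma rescale_exp_mul_rescale_exp (a b : ℂ) :
    PowerSeries.rescale a (PowerSeries.exp ℂ) * PowerSeries.rescale b (PowerSeries.exp ℂ) =
      PowerSeries.rescale (a + b) (PowerSeries.exp ℂ) :=
  PowerSeries.exp_mul_exp_eq_exp_add a b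

lemma integral_inv_cosh_pow_complex (n : ℕ) :
    ∫ v : ℝ, (((Real.cosh (Real.pi * v))⁻¹ ^ n : ℝ) : ℂ) = sechMoment 0 n := by
  rw [integral_complex_ofReal, sechMoment]
  simp

-- Formally ∫ e^{xv} sech(πv) dv = 1/cos(x/2). The contour shift with n = 1 cancels all coefficients
-- with k ≥ 1; k = 0 gives twice the total mass 1.
open Complex in
lemma sechSeries_one_mul :
    sechSeries 1 * (PowerSeries.rescale (I / 2) (PowerSeries.exp ℂ) +
      PowerSeries.rescale (-(I / 2)) (PowerSeries.exp ℂ)) = 2 := by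
  ext k
  rw [mul_add, map_add, coeff_sechSeries_mul_rescale_exp one_ne_zero,
    coeff_sechSeries_mul_rescale_exp one_ne_zero,
    show (2 : PowerSeries ℂ) = PowerSeries.C (2 : ℂ) from
      (map_ofNat PowerSeries.C 2).symm, PowerSeries.coeff_C]
  rcases Nat.eq_zero_or_pos k with rfl | hk
  · simp only [pow_zero, one_mul, integral_inv_cosh_pow_complex, sechMoment_zero_one]
    norm_num
  · rw [integral_add_half_I_pow one_ne_zero hk, if_neg hk.ne']
    ring

-- Formally ∫ e^{xv} sech²(πv) dv = (x/π)/sin(x/2). The contour shift covers only k ≥ 2; k = 1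
-- contributes i ∫ sech²(πv) dv = 2i/π.
open Complex in
lemma sechSeries_two_mul :
    sechSeries 2 * (PowerSeries.rescale (I / 2) (PowerSeries.exp ℂ) -
      PowerSeries.rescale (-(I / 2)) (PowerSeries.exp ℂ)) =
      PowerSeries.C (2 * I / Real.pi) * PowerSeries.X := by
  ext k
  rw [mul_sub, map_sub, coeff_sechSeries_mul_rescale_exp two_ne_zero,
    coeff_sechSeries_mul_rescale_exp two_ne_zero, PowerSeries.coeff_C_mul, PowerSeries.coeff_X]
  by_cases hk : 2 ≤ k
  · rw [integral_add_half_I_pow two_ne_zero hk, if_neg (by omega)]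
    ring
  · interval_cases k
    · simp
    · rw [← sub_div, ← integral_sub (integrable_add_pow_mul_inv_cosh_pow _ 1 two_ne_zero)
        (integrable_add_pow_mul_inv_cosh_pow _ 1 two_ne_zero)]
      have e : ∀ v : ℝ, ((v : ℂ) + I / 2) ^ 1 * (((Real.cosh (Real.pi * v))⁻¹ ^ 2 : ℝ) : ℂ) -
          ((v : ℂ) + -(I / 2)) ^ 1 * (((Real.cosh (Real.pi * v))⁻¹ ^ 2 : ℝ) : ℂ) =
          I * (((Real.cosh (Real.pi * v))⁻¹ ^ 2 : ℝ) : ℂ) := by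
        intro v; ring
      simp only [e]
      rw [integral_const_mul, integral_inv_cosh_pow_complex, sechMoment_zero_two]
      push_cast
      simp
      ring

-- The substitution x ↦ ix turns 2e^{x/2}/(e^x + 1) into 1/cos(x/2), and (-2i)^{-k} 2^k = i^k.
open Complex PowerSeries in
lemma higherEuler_one (k : ℕ) : higherEuler k 1 = (sechMoment k 1 : ℂ) := by
  obtain ⟨H, hH⟩ : ∃ H : PowerSeries ℂ, H = 2 * rescale (1 / 2 : ℂ) (exp ℂ) * (exp ℂ + 1)⁻¹ :=
    ⟨_, rfl⟩
  have h1 : H * (exp ℂ + 1) = 2 * rescale (1 / 2 : ℂ) (exp ℂ) := by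
    rw [hH, mul_assoc, PowerSeries.inv_mul_cancel _ (by simp), mul_one]
  have h2 := congrArg (rescale I) h1
  have hre : ∀ a : ℂ, rescale I (rescale a (exp ℂ)) = rescale (a * I) (exp ℂ) := fun a => by
    rw [rescale_rescale, mul_comm]
  rw [map_mul, map_mul _ 2, hre, map_add, map_one, map_ofNat, show (1 / 2 : ℂ) * I = I / 2 by ring] at h2
  have hne : rescale I (exp ℂ) + 1 ≠ 0 := by
    intro h
    have := congrArg (coeff 0) h
    rw [map_add, coeff_rescale_exp] at this
    norm_num at this
  have h3 : sechSeries 1 * (rescale I (exp ℂ) + 1) = 2 * rescale (I / 2) (exp ℂ) := by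
    rw [← sechSeries_one_mul, mul_assoc, add_mul, rescale_exp_mul_rescale_exp,
      rescale_exp_mul_rescale_exp]
    congr 2
    · congr 2; ring
    · rw [neg_add_cancel, rescale_zero_apply]; simp
  have h4 : sechSeries 1 = rescale I H := mul_right_cancel₀ hne (h3.trans h2.symm)
  have h5 := congrArg (coeff k) h4
  rw [sechSeries, coeff_mk, coeff_rescale] at h5
  have hfac : (k.factorial : ℂ) ≠ 0 := by exact_mod_cast k.factorial_ne_zero
  rw [div_eq_iff hfac] at h5
  rw [h5, higherEuler, eulerNumber, eulerPoly, ← hH, zpow_neg, zpow_natCast, ← inv_pow,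
    show (-2 * I)⁻¹ = I / 2 by rw [mul_inv, inv_I]; ring, div_pow]
  field_simp

-- The substitution x ↦ -ix, matching i^{-k} = (-i)^k, turns x e^{x/2}/(e^x - 1) into
-- (x/2)/sin(x/2).
open Complex PowerSeries in
lemma higherEuler_two (k : ℕ) : higherEuler k 2 = (sechMoment k 2 : ℂ) := by
  have h1 := Polynomial.bernoulli_generating_function (1 / 2 : ℂ)
  set B : PowerSeries ℂ :=
    PowerSeries.mk fun n => Polynomial.aeval (1 / 2 : ℂ) ((1 / n.factorial : ℚ) •
      Polynomial.bernoulli n) with hB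
  have h2 := congrArg (rescale (-I)) h1
  have hre : ∀ a : ℂ, rescale (-I) (rescale a (exp ℂ)) = rescale (a * -I) (exp ℂ) := fun a => by
    rw [rescale_rescale, mul_comm]
  rw [map_mul, map_mul, hre, map_sub, map_one, rescale_X,
    show (1 / 2 : ℂ) * -I = -(I / 2) by ring] at h2
  have hne : rescale (-I) (exp ℂ) - 1 ≠ 0 := by
    intro h
    have := congrArg (coeff 1) h
    rw [map_sub, coeff_rescale_exp, coeff_one] at this
    norm_num at this
  have h3 : sechSeries 2 * (rescale (-I) (exp ℂ) - 1) =
      C (-(2 * I / Real.pi) : ℂ) * X * rescale (-(I / 2)) (exp ℂ) := by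
    rw [map_neg, neg_mul, ← sechSeries_two_mul, ← mul_neg, mul_assoc, neg_sub, sub_mul,
      rescale_exp_mul_rescale_exp, rescale_exp_mul_rescale_exp]
    congr 2
    · congr 2; ring
    · rw [add_neg_cancel, rescale_zero_apply]; simp
  have h4 : sechSeries 2 = C (2 / Real.pi : ℂ) * rescale (-I) B := by
    refine mul_right_cancel₀ hne (h3.trans ?_)
    rw [mul_assoc (C _) (rescale (-I) B), h2, ← mul_assoc, ← mul_assoc, ← map_mul]
    congr 3
    ring_nf
  have h5 := congrArg (coeff k) h4
  rw [sechSeries, coeff_mk, coeff_C_mul, coeff_rescale, hB, coeff_mk, map_smul] at h5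
  have hfac : (k.factorial : ℂ) ≠ 0 := by exact_mod_cast k.factorial_ne_zero
  rw [div_eq_iff hfac] at h5
  rw [h5, higherEuler, zpow_neg, zpow_natCast, ← inv_pow, inv_I, Algebra.smul_def]
  simp
  field_simp

/-- The higher Euler numbers are the moments of the powers of the hyperbolic secant. -/
lemma higherEuler_eq_sechMoment (k : ℕ) (n : ℕ) :
    higherEuler k (n + 1) = (sechMoment k (n + 1) : ℂ) := by
  -- The order k stays general because the recursion in n also refers to k - 2.
  induction n using Nat.twoStepInduction generalizing k with
  | zero => exact higherEuler_one k
  | one => exact higherEuler_two k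
  | more n ih _ =>
    have h := congrArg (fun x : ℝ => (x : ℂ)) (sechMoment_recursion k (n := n + 1) (by omega))
    push_cast at h
    have hpi : (Real.pi : ℂ) ≠ 0 := by exact_mod_cast Real.pi_pos.ne'
    have hn1 : (n : ℂ) + 1 ≠ 0 := by exact_mod_cast n.succ_ne_zero
    have hn2 : (n : ℂ) + 2 ≠ 0 := by exact_mod_cast (n + 1).succ_ne_zero
    have hif : (k : ℂ) * (k - 1) * (if k < 2 then 0 else higherEuler (k - 2) (n + 1)) =
        k * (k - 1) * sechMoment (k - 2) (n + 1) := by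
      split_ifs with hk
      · interval_cases k <;> simp
      · rw [ih]
    rw [show n + 2 + 1 = n + 3 from rfl, higherEuler, ih, div_mul_eq_mul_div _ _ (ite _ _ _), hif]
    rw [show n + 1 + 2 = n + 3 from rfl, show (n : ℂ) + 1 + 1 = n + 2 by ring] at h
    field_simp
    linear_combination -h

/-! ### Taylor expansion and tails of the Fourier transform of sech^m -/

-- The bound holds for all real y, so that it can be integrated against sech^m. For |y| ≤ 1 the
-- constant comes from e ≤ 3; for |y| ≥ 1 each of the n + 1 pieces is at most |y|^n.
open Complex in
lemma norm_exp_I_mul_sub_sum_le (y : ℝ) (n : ℕ) :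
    ‖exp (y * I) - ∑ k ∈ Finset.range n, (y * I) ^ k / (k.factorial : ℂ)‖ ≤ (n + 3) * |y| ^ n := by
  have hy : ‖(y : ℂ) * I‖ = |y| := by simp
  rcases le_total |y| 1 with h | h
  · refine (norm_exp_sub_sum_le_norm_mul_exp _ n).trans ?_
    rw [hy, mul_comm]
    have : Real.exp |y| ≤ 3 := (Real.exp_le_exp.mpr h).trans (by linarith [Real.exp_one_lt_d9])
    gcongr
    linarith [(Nat.cast_nonneg n : (0 : ℝ) ≤ n)]
  · have h1 : (1 : ℝ) ≤ |y| ^ n := one_le_pow₀ h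
    refine (norm_sub_le _ _).trans ?_
    rw [norm_exp_ofReal_mul_I]
    have h2 : ‖∑ k ∈ Finset.range n, ((y : ℂ) * I) ^ k / (k.factorial : ℂ)‖ ≤
        ∑ k ∈ Finset.range n, |y| ^ n := by
      refine norm_sum_le_of_le _ fun k hk => ?_
      rw [norm_div, norm_pow, hy, norm_natCast]
      refine (div_le_self (by positivity) (by exact_mod_cast k.factorial_pos)).trans ?_
      exact pow_le_pow_right₀ h (Finset.mem_range.mp hk).le
    rw [Finset.sum_const, Finset.card_range, nsmul_eq_mul] at h2
    linarith

/-- The integrand of the Fourier transform of a power of the hyperbolic secant. -/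
def sechFourierIntegrand (m : ℕ) (c : ℝ) (v : ℝ) : ℂ :=
  (((Real.cosh (Real.pi * v))⁻¹ ^ m : ℝ) : ℂ) * Complex.exp ((c * v : ℝ) * Complex.I)

lemma norm_sechFourierIntegrand (m : ℕ) (c v : ℝ) :
    ‖sechFourierIntegrand m c v‖ = (Real.cosh (Real.pi * v))⁻¹ ^ m := by
  rw [sechFourierIntegrand, norm_mul, Complex.norm_exp_ofReal_mul_I, mul_one, Complex.norm_real,
    Real.norm_of_nonneg (pow_pos (inv_cosh_pos _) m).le]

lemma continuous_sechFourierIntegrand (m : ℕ) (c : ℝ) :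
    Continuous (sechFourierIntegrand m c) :=
  (Complex.continuous_ofReal.comp (continuous_inv_cosh.pow m)).mul (by fun_prop)

lemma integrable_sechFourierIntegrand {m : ℕ} (hm : m ≠ 0) (c : ℝ) :
    Integrable (sechFourierIntegrand m c) := by
  refine (integrable_pow_mul_inv_cosh_pow 0 hm).mono'
    (continuous_sechFourierIntegrand m c).aestronglyMeasurable (ae_of_all _ fun v => ?_)
  rw [norm_sechFourierIntegrand]
  simp

/-- The absolute moments of the powers of the hyperbolic secant. -/
def sechAbsMoment (k n : ℕ) : ℝ := ∫ v : ℝ, |v| ^ k * (Real.cosh (Real.pi * v))⁻¹ ^ n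

lemma integrable_abs_pow_mul_inv_cosh_pow (k : ℕ) {n : ℕ} (hn : n ≠ 0) :
    Integrable fun v : ℝ => |v| ^ k * (Real.cosh (Real.pi * v))⁻¹ ^ n := by
  refine (integrable_pow_mul_inv_cosh_pow k hn).norm.congr (ae_of_all _ fun v => ?_)
  simp only [norm_mul, norm_pow, Real.norm_eq_abs]
  rw [abs_of_pos (inv_cosh_pos (Real.pi * v))]

open Complex in
lemma norm_integral_sechFourier_sub_le {m : ℕ} (hm : m ≠ 0) (N : ℕ) (c : ℝ) :
    ‖(∫ v, sechFourierIntegrand m c v) -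
      ∑ k ∈ Finset.range N, (c * I) ^ k / (k.factorial : ℂ) * (sechMoment k m : ℂ)‖ ≤
      (N + 3) * |c| ^ N * sechAbsMoment N m := by
  have hint : ∀ k : ℕ, Integrable fun v : ℝ => (c * I) ^ k / (k.factorial : ℂ) *
      ((v ^ k * (Real.cosh (Real.pi * v))⁻¹ ^ m : ℝ) : ℂ) := fun k =>
    ((integrable_pow_mul_inv_cosh_pow k hm).ofReal (𝕜 := ℂ)).const_mul _
  have hsum : ∑ k ∈ Finset.range N, (c * I) ^ k / (k.factorial : ℂ) * (sechMoment k m : ℂ) =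
      ∫ v : ℝ, ∑ k ∈ Finset.range N, (c * I) ^ k / (k.factorial : ℂ) *
        ((v ^ k * (Real.cosh (Real.pi * v))⁻¹ ^ m : ℝ) : ℂ) := by
    rw [integral_finsetSum _ fun k _ => hint k]
    refine Finset.sum_congr rfl fun k _ => ?_
    rw [integral_const_mul, integral_complex_ofReal, sechMoment]
  rw [hsum, ← integral_sub (integrable_sechFourierIntegrand hm c)
    (integrable_finsetSum _ fun k _ => hint k), sechAbsMoment, ← integral_const_mul]
  refine norm_integral_le_of_norm_le ((integrable_abs_pow_mul_inv_cosh_pow N hm).const_mul _)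
    (ae_of_all _ fun v => ?_)
  have e : sechFourierIntegrand m c v - ∑ k ∈ Finset.range N, (c * I) ^ k / (k.factorial : ℂ) *
        ((v ^ k * (Real.cosh (Real.pi * v))⁻¹ ^ m : ℝ) : ℂ) =
      (((Real.cosh (Real.pi * v))⁻¹ ^ m : ℝ) : ℂ) * (exp ((c * v : ℝ) * I) -
        ∑ k ∈ Finset.range N, ((c * v : ℝ) * I) ^ k / (k.factorial : ℂ)) := by
    rw [mul_sub, Finset.mul_sum, sechFourierIntegrand]
    congr 1
    refine Finset.sum_congr rfl fun k _ => ?_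
    push_cast
    ring
  rw [e, norm_mul, norm_real, Real.norm_of_nonneg (pow_pos (inv_cosh_pos _) m).le]
  calc (Real.cosh (Real.pi * v))⁻¹ ^ m * ‖_‖
      ≤ (Real.cosh (Real.pi * v))⁻¹ ^ m * ((N + 3) * |c * v| ^ N) :=
        mul_le_mul_of_nonneg_left (norm_exp_I_mul_sub_sum_le _ _) (pow_pos (inv_cosh_pos _) m).le
    _ = _ := by rw [abs_mul, mul_pow]; ring

lemma norm_integral_sechFourier_tail_le {m : ℕ} (hm : m ≠ 0) (k : ℕ) (c : ℝ) {A : ℝ} (hA : 0 < A) :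
    ‖(∫ v in -A..A, sechFourierIntegrand m c v) - ∫ v, sechFourierIntegrand m c v‖ ≤
      (A ^ k)⁻¹ * sechAbsMoment k m := by
  have hi := integrable_sechFourierIntegrand hm c
  rw [intervalIntegral.integral_of_le (by linarith),
    ← integral_add_compl (measurableSet_Ioc (a := -A) (b := A)) hi, sub_add_cancel_left, norm_neg,
    sechAbsMoment, ← integral_const_mul]
  have hb := (integrable_abs_pow_mul_inv_cosh_pow k hm).const_mul (A ^ k)⁻¹
  have hnn : ∀ v : ℝ, 0 ≤ (Real.cosh (Real.pi * v))⁻¹ ^ m := fun v => (pow_pos (inv_cosh_pos _) m).le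
  refine (norm_integral_le_of_norm_le hb.integrableOn ?_).trans
    (setIntegral_le_integral hb (ae_of_all _ fun v => ?_))
  · refine (ae_restrict_iff' measurableSet_Ioc.compl).mpr (ae_of_all _ fun v hv => ?_)
    have hv' : A ≤ |v| := by
      by_contra h
      rw [not_le, abs_lt] at h
      exact hv ⟨h.1, h.2.le⟩
    rw [norm_sechFourierIntegrand, ← mul_assoc]
    refine le_mul_of_one_le_left (hnn v) ?_
    rw [inv_mul_eq_div, one_le_div (by positivity)]
    gcongr
  · have := hnn v
    simp only [Pi.zero_apply]
    positivity

/-! ### Analyticity of the generating function and approximation of its Laurent coefficients -/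

open Complex in
lemma genF_exp_add_one (m : ℕ) (τ z : ℂ) :
    genF m τ (exp (2 * Real.pi * I * (z + 1))) = genF m τ (exp (2 * Real.pi * I * z)) := by
  rw [exp_two_pi_I_mul_add_one]

open Complex in
lemma differentiableOn_genF (m : ℕ) {τ : ℂ} (hτ : 0 < τ.im) :
    DifferentiableOn ℂ (fun z => genF m τ (exp (2 * Real.pi * I * z)))
      {z | |z.im| < τ.im / 2} := by
  have hd := differentiable_tripleProd hτ
  have h : DifferentiableOn ℂ (fun z => (tripleProd τ z / tripleProd τ (z + 1 / 2)) ^ m)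
      {z | |z.im| < τ.im / 2} := by
    refine (hd.differentiableOn.div (hd.comp (by fun_prop)).differentiableOn fun z hz => ?_).pow m
    refine tripleProd_ne_zero ?_
    have : ((1 : ℂ) / 2).im = 0 := by norm_num
    rwa [add_im, this, add_zero]
  exact h.congr fun z hz => genF_eq m hz

open Complex in
lemma hasSum_chF (m : ℕ) {τ : ℂ} (hτ : 0 < τ.im) {z : ℂ} (hz : |z.im| < τ.im / 2) :
    HasSum (fun r : ℤ => chF m r τ * exp (2 * Real.pi * I * z) ^ r)
      (genF m τ (exp (2 * Real.pi * I * z))) :=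
  hasSum_laurent_of_periodic (differentiableOn_genF m hτ) (genF_exp_add_one m τ) hz

open Complex in
/-- Approximation of the Laurent coefficients for `τ = i t` by the Fourier transform of a power of
the hyperbolic secant. -/
lemma exists_chF_bound {m : ℕ} (hm : 1 < m) (r : ℤ) (k : ℕ) :
    ∃ C D : ℝ, ∀ t : ℝ, 0 < t → t ≤ 1 →
      ‖chF m r (I * t) * (((2 * Real.exp (-(Real.pi / (4 * t)))) ^ m : ℝ) : ℂ) -
        t * ∫ v, sechFourierIntegrand m (-(2 * Real.pi * r * t)) v‖ ≤
      C * Real.exp (-(Real.pi / t)) + D * t ^ (k + 1) := by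
  obtain ⟨C, hC0, hC⟩ := exists_gaussSum_quotient_bound hm
  -- Under u = t v the cut-off is A = 1/(2t), so the tail contributes A^{-k} = (2t)^k, times the
  -- Jacobian t.
  refine ⟨C, 2 ^ k * sechAbsMoment k m, fun t ht ht1 => ?_⟩
  have hτ : 0 < (I * t).im := by simpa using ht
  set c := -(2 * Real.pi * r * t) with hc
  set K : ℝ := (2 * Real.exp (-(Real.pi / (4 * t)))) ^ m with hK
  have hcont : Continuous fun u : ℝ => genF m (I * t) (exp (2 * Real.pi * I * u)) := by
    have := continuous_line (differentiableOn_genF m hτ) (y := 0) (by simpa using ht)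
    simpa using this
  have hscale : ∫ u in (-(1 / 2) : ℝ)..(1 / 2), sechFourierIntegrand m c (u / t) =
      t * ∫ v in (-(1 / (2 * t)))..(1 / (2 * t)), sechFourierIntegrand m c v := by
    rw [intervalIntegral.integral_comp_div _ ht.ne', real_smul]
    congr 2 <;> field_simp
  have h1 : ‖chF m r (I * t) * (K : ℂ) -
      ∫ u in (-(1 / 2) : ℝ)..(1 / 2), sechFourierIntegrand m c (u / t)‖ ≤
      C * Real.exp (-(Real.pi / t)) := by
    rw [chF, ← intervalIntegral.integral_mul_const, ← intervalIntegral.integral_sub]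
    · refine (intervalIntegral.norm_integral_le_of_norm_le_const
        (C := C * Real.exp (-(Real.pi / t))) fun u hu => ?_).trans (by norm_num)
      rw [Set.uIoc_of_le (by norm_num)] at hu
      have hu' : |u| ≤ 1 / 2 := abs_le.mpr ⟨hu.1.le, hu.2⟩
      have hexp : exp (-(2 * Real.pi * I * r * u)) = exp ((c * (u / t) : ℝ) * I) := by
        have ht' : (t : ℂ) ≠ 0 := by exact_mod_cast ht.ne'
        congr 1; rw [hc]; push_cast; field_simp
      rw [genF_eq_gaussSum m ht, hexp, sechFourierIntegrand,
        show ∀ a b e d : ℂ, a * b * e - d * b = (a * e - d) * b by intros; ring, norm_mul,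
        norm_exp_ofReal_mul_I, mul_one, ← ofReal_mul, ← ofReal_sub, norm_real, Real.norm_eq_abs,
        ← mul_div_assoc]
      exact hC t ht ht1 u hu'
    · exact ((hcont.mul (by fun_prop)).mul continuous_const).intervalIntegrable _ _
    · exact ((continuous_sechFourierIntegrand m c).comp
        (by fun_prop : Continuous fun u : ℝ => u / t)).intervalIntegrable _ _
  have h2 := norm_integral_sechFourier_tail_le (m := m) (by omega) k c
    (A := 1 / (2 * t)) (by positivity)
  have h3 : ‖(∫ u in (-(1 / 2) : ℝ)..(1 / 2), sechFourierIntegrand m c (u / t)) -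
      t * ∫ v, sechFourierIntegrand m c v‖ ≤ 2 ^ k * sechAbsMoment k m * t ^ (k + 1) := by
    rw [hscale, ← mul_sub, norm_mul, norm_real, Real.norm_of_nonneg ht.le]
    refine (mul_le_mul_of_nonneg_left h2 ht.le).trans (le_of_eq ?_)
    rw [div_pow, one_pow, one_div, inv_inv, mul_pow]
    ring
  calc _ ≤ _ := norm_sub_le_norm_sub_add_norm_sub _
          (∫ u in (-(1 / 2) : ℝ)..(1 / 2), sechFourierIntegrand m c (u / t)) _
    _ ≤ _ := add_le_add h1 h3

/-! ### Modular inversion of the Euler function -/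

open Complex in
/-- The modular transformation of the Euler function on the imaginary axis. -/
lemma tprod_one_sub_qPow {t : ℝ} (ht : 0 < t) :
    ∏' k : ℕ, (1 - qPow (I * t) (k + 1)) =
      ((Real.exp (Real.pi * t / 12) * Real.exp (-(Real.pi / (12 * t))) / Real.sqrt t : ℝ) : ℂ) *
        ∏' k : ℕ, (1 - ((Real.exp (-(2 * Real.pi / t)) : ℝ) : ℂ) ^ (k + 1)) := by
  have ht' : (t : ℂ) ≠ 0 := by exact_mod_cast ht.ne'
  have hmem : (I * t : ℂ) ∈ UpperHalfPlane.upperHalfPlaneSet := by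
    change 0 < (I * t : ℂ).im
    simpa using ht
  have h := ModularForm.eta_comp_eq_csqrt_I_inv hmem
  have hI : (-1 / (I * t) : ℂ) = I / t := by field_simp; rw [I_sq]
  have hsqrt : sqrt (I * t) = (Real.sqrt t : ℂ) * sqrt I := by
    rw [sqrt_eq_exp (mul_ne_zero I_ne_zero ht'), sqrt_eq_exp I_ne_zero, mul_comm I,
      log_ofReal_mul ht I_ne_zero, add_div, exp_add, Real.sqrt_eq_rpow, Real.rpow_def_of_pos ht]
    push_cast
    congr 2; ring
  have hsI : sqrt I ≠ 0 := by rw [sqrt_eq_exp I_ne_zero]; exact exp_ne_zero _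
  simp only [Function.comp_apply, Pi.smul_apply, Pi.mul_apply, smul_eq_mul] at h
  rw [hI, hsqrt, ModularForm.eta, ModularForm.eta] at h
  have e1 : (fun n : ℕ => 1 - ModularForm.eta_q n (I / t)) = fun n : ℕ =>
      1 - ((Real.exp (-(2 * Real.pi / t)) : ℝ) : ℂ) ^ (n + 1) := by
    ext n
    rw [ModularForm.eta_q_eq_pow, ofReal_exp]
    congr 3
    push_cast
    field_simp
    rw [I_sq]
  have e2 : (fun n : ℕ => 1 - ModularForm.eta_q n (I * t)) = fun n : ℕ =>
      1 - qPow (I * t) (n + 1) := by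
    ext n
    rw [ModularForm.eta_q_eq_cexp, qPow]
  have e3 : Function.Periodic.qParam 24 (I / t) = (Real.exp (-(Real.pi / (12 * t))) : ℝ) := by
    rw [Function.Periodic.qParam, ofReal_exp]
    congr 1
    push_cast
    field_simp
    rw [I_sq]
    norm_num
  have e4 : Function.Periodic.qParam 24 (I * t) = ((Real.exp (Real.pi * t / 12))⁻¹ : ℝ) := by
    rw [Function.Periodic.qParam, ← Real.exp_neg, ofReal_exp]
    congr 1
    push_cast
    linear_combination (Real.pi * t / 12 : ℂ) * I_mul_I
  rw [e1, e2, e3, e4] at h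
  have hst : ((Real.sqrt t : ℝ) : ℂ) ≠ 0 := ofReal_ne_zero.mpr (Real.sqrt_pos.mpr ht).ne'
  have he : ((Real.exp (Real.pi * t / 12) : ℝ) : ℂ) ≠ 0 := ofReal_ne_zero.mpr (Real.exp_pos _).ne'
  rw [ofReal_div, ofReal_mul, div_mul_eq_mul_div, mul_assoc, h]
  rw [ofReal_inv]
  field_simp

lemma exp_neg_div_isBigO {c : ℝ} (hc : 0 < c) (n : ℕ) :
    (fun t : ℝ => Real.exp (-(c / t))) =O[𝓝[>] (0 : ℝ)] fun t : ℝ => t ^ n := by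
  refine Asymptotics.IsBigO.of_bound (n.factorial / c ^ n) ?_
  filter_upwards [self_mem_nhdsWithin] with t ht
  have ht0 : 0 < t := ht
  rw [Real.norm_of_nonneg (Real.exp_pos _).le, Real.norm_of_nonneg (by positivity), Real.exp_neg]
  have h := Real.pow_div_factorial_le_exp (c / t) (by positivity) n
  calc (Real.exp (c / t))⁻¹ ≤ ((c / t) ^ n / n.factorial)⁻¹ := by gcongr
    _ = _ := by
      rw [div_pow]
      field_simp

/-- The Euler function equals 1 at q = 0 and is differentiable there, so its difference from 1 is
O(e^{-2π/t}). -/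
lemma eulerFunction_sub_one_isBigO (n : ℕ) :
    (fun t : ℝ => (∏' k : ℕ, (1 - ((Real.exp (-(2 * Real.pi / t)) : ℝ) : ℂ) ^ (k + 1))) - 1)
      =O[𝓝[>] (0 : ℝ)] fun t : ℝ => t ^ n := by
  have hexp := exp_neg_div_isBigO (c := 2 * Real.pi) (by positivity) n
  have htop : Tendsto (fun t : ℝ => 2 * Real.pi / t) (𝓝[>] 0) atTop := by
    simp only [div_eq_mul_inv]
    exact tendsto_inv_nhdsGT_zero.const_mul_atTop (by positivity)
  have hlim : Tendsto (fun t : ℝ => ((Real.exp (-(2 * Real.pi / t)) : ℝ) : ℂ)) (𝓝[>] 0) (𝓝 0) := by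
    rw [← Complex.ofReal_zero]
    exact (Complex.continuous_ofReal.tendsto _).comp
      (Real.tendsto_exp_neg_atTop_nhds_zero.comp htop)
  have hd : DifferentiableAt ℂ (fun q : ℂ => ∏' k : ℕ, (1 - q ^ (k + 1))) 0 :=
    ModularForm.differentiableOn_tprod_one_sub_pow.differentiableAt
      (Metric.isOpen_ball.mem_nhds (Metric.mem_ball_self one_pos))
  have h := hd.isBigO_sub.comp_tendsto hlim
  simp only [Function.comp_def, sub_zero, ne_eq, Nat.add_eq_zero_iff, one_ne_zero, and_false,
    not_false_eq_true, zero_pow, tprod_one] at h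
  refine h.trans ((Asymptotics.IsBigO.of_norm_left ?_).trans hexp)
  simp only [Complex.norm_real]
  exact (Asymptotics.isBigO_refl _ _).norm_left

/-! ### Assembly of the expansion -/

open Complex in
lemma sum_coeffA_eq {m : ℕ} (hm : m ≠ 0) (r : ℤ) (N : ℕ) (t : ℝ) :
    ∑ k ∈ Finset.range N, coeffA k m r * ((t : ℂ) ^ k / (k.factorial : ℂ)) =
      ∑ k ∈ Finset.range N, (((-(2 * Real.pi * r * t) : ℝ) : ℂ) * I) ^ k / (k.factorial : ℂ) *
        (sechMoment k m : ℂ) := by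
  obtain ⟨m, rfl⟩ := Nat.exists_eq_succ_of_ne_zero hm
  refine Finset.sum_congr rfl fun k _ => ?_
  rw [coeffA, higherEuler_eq_sechMoment, show (((-(2 * Real.pi * r * t) : ℝ) : ℂ) * I) =
    (-2 * Real.pi * I * r) * t by push_cast; ring, mul_pow _ (t : ℂ)]
  ring

open Complex in
/-- The asymptotic expansion of the normalized Laurent coefficients. -/
lemma chF_sub_sum_isBigO {m : ℕ} (hm : 1 < m) (r : ℤ) (N : ℕ) :
    (fun t : ℝ => chF m r (I * t) * (((2 * Real.exp (-(Real.pi / (4 * t)))) ^ m : ℝ) : ℂ) / t -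
      ∑ k ∈ Finset.range N, coeffA k m r * ((t : ℂ) ^ k / (k.factorial : ℂ)))
      =O[𝓝[>] (0 : ℝ)] fun t : ℝ => t ^ N := by
  obtain ⟨C, D, h⟩ := exists_chF_bound hm r N
  have hexp := (exp_neg_div_isBigO Real.pi_pos (N + 1)).const_mul_left C
  have hpow : (fun t : ℝ => D * t ^ (N + 1)) =O[𝓝[>] (0 : ℝ)] fun t : ℝ => t ^ (N + 1) :=
    (Asymptotics.isBigO_refl _ _).const_mul_left D
  have h1 : (fun t : ℝ => chF m r (I * t) * (((2 * Real.exp (-(Real.pi / (4 * t)))) ^ m : ℝ) : ℂ) -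
      t * ∫ v, sechFourierIntegrand m (-(2 * Real.pi * r * t)) v) =O[𝓝[>] (0 : ℝ)]
      fun t : ℝ => t ^ (N + 1) := by
    refine Asymptotics.IsBigO.trans (Asymptotics.IsBigO.of_bound 1 ?_) (hexp.add hpow)
    filter_upwards [Ioc_mem_nhdsGT (zero_lt_one' ℝ)] with t ht
    rw [one_mul]
    exact (h t ht.1 ht.2).trans (Real.le_norm_self _)
  -- Removing the Jacobian t costs one order, which is why the previous bound was taken to order N +
  -- 1.
  have h2 : (fun t : ℝ => (t : ℂ)⁻¹ *
      (chF m r (I * t) * (((2 * Real.exp (-(Real.pi / (4 * t)))) ^ m : ℝ) : ℂ) -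
      t * ∫ v, sechFourierIntegrand m (-(2 * Real.pi * r * t)) v)) =O[𝓝[>] (0 : ℝ)]
      fun t : ℝ => t ^ N := by
    have hinv : (fun t : ℝ => (t : ℂ)⁻¹) =O[𝓝[>] (0 : ℝ)] fun t : ℝ => t⁻¹ :=
      Asymptotics.IsBigO.of_bound 1 (.of_forall fun t => by simp)
    refine (hinv.mul h1).congr' .rfl ?_
    filter_upwards [self_mem_nhdsWithin] with t ht
    have ht0 : t ≠ 0 := ne_of_gt ht
    field_simp
    ring
  have h3 : (fun t : ℝ => (∫ v, sechFourierIntegrand m (-(2 * Real.pi * r * t)) v) -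
      ∑ k ∈ Finset.range N, coeffA k m r * ((t : ℂ) ^ k / (k.factorial : ℂ)))
      =O[𝓝[>] (0 : ℝ)] fun t : ℝ => t ^ N := by
    refine Asymptotics.IsBigO.of_bound
      ((N + 3) * |2 * Real.pi * r| ^ N * sechAbsMoment N m) (.of_forall fun t => ?_)
    rw [sum_coeffA_eq (by omega) r N t]
    refine (norm_integral_sechFourier_sub_le (by omega) N _).trans (le_of_eq ?_)
    rw [abs_neg, abs_mul, mul_pow, norm_pow, Real.norm_eq_abs]
    ring
  refine (h2.add h3).congr' ?_ .rfl
  filter_upwards [self_mem_nhdsWithin] with t ht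
  have ht0 : (t : ℂ) ≠ 0 := ofReal_ne_zero.mpr (ne_of_gt ht)
  field_simp
  ring

-- Collects the prefactors: undoing the normalization (2e^{-π/(4t)})^m gives 2^{-m} and the 3m in
-- the exponent, eta inversion gives the -1 and t^{-1/2}, and the Jacobian t makes this √t.
open Complex in
lemma trL_eq (m : ℕ) (r : ℤ) {t : ℝ} (ht : 0 < t) :
    trL m r (I * t) =
      ((Real.exp (Real.pi * t / 12 + Real.pi / (12 * t) * (3 * (m : ℝ) - 1)) *
        (Real.sqrt t / 2 ^ m) : ℝ) : ℂ) *
      (chF m r (I * t) * (((2 * Real.exp (-(Real.pi / (4 * t)))) ^ m : ℝ) : ℂ) / t *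
        ∏' k : ℕ, (1 - ((Real.exp (-(2 * Real.pi / t)) : ℝ) : ℂ) ^ (k + 1))) := by
  have hreal : Real.exp (Real.pi * t / 12) * Real.exp (-(Real.pi / (12 * t))) / Real.sqrt t =
      Real.exp (Real.pi * t / 12 + Real.pi / (12 * t) * (3 * (m : ℝ) - 1)) *
        (Real.sqrt t / 2 ^ m) * (2 * Real.exp (-(Real.pi / (4 * t)))) ^ m / t := by
    have e : Real.exp (Real.pi * t / 12 + Real.pi / (12 * t) * (3 * (m : ℝ) - 1)) *
        Real.exp (-(Real.pi / (4 * t))) ^ m =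
        Real.exp (Real.pi * t / 12) * Real.exp (-(Real.pi / (12 * t))) := by
      rw [← Real.exp_nat_mul, ← Real.exp_add, ← Real.exp_add]
      congr 1
      field_simp
      ring
    rw [← e, mul_pow]
    have hs := (Real.sqrt_pos.mpr ht).ne'
    have hst := Real.sq_sqrt ht.le
    field_simp
    linear_combination -hst
  rw [trL, tprod_one_sub_qPow ht, hreal]
  push_cast
  ring

end KacWakimoto

end

/-- The first conjunct says that `chF` really collects the coefficients of the generating function
on the whole range `|Im z| < Im τ / 2`; the second is the asymptotic expansion as `t → 0⁺`. -/
theorem theorem1p3 (m : ℕ) (hm : 1 < m) :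
    (∀ τ : ℂ, 0 < τ.im → ∀ z : ℂ, |z.im| < τ.im / 2 →
      HasSum
        (fun r : ℤ => KacWakimoto.chF m r τ * Complex.exp (2 * Real.pi * Complex.I * z) ^ r)
        (KacWakimoto.genF m τ (Complex.exp (2 * Real.pi * Complex.I * z)))) ∧
    ∀ (r : ℤ) (N : ℕ), ∃ R : ℝ → ℂ,
      R =O[𝓝[>] (0 : ℝ)] (fun t : ℝ => t ^ (N + 1)) ∧
      ∀ t : ℝ, 0 < t →
        KacWakimoto.trL m r (Complex.I * t) =
          ((Real.exp (Real.pi * t / 12 + Real.pi / (12 * t) * (3 * (m : ℝ) - 1)) *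
              (Real.sqrt t / 2 ^ m) : ℝ) : ℂ) *
            (∑ k ∈ Finset.range (N + 1),
                KacWakimoto.coeffA k m r * ((t : ℂ) ^ k / (k.factorial : ℂ)) + R t) := by
  refine ⟨fun τ hτ z hz => KacWakimoto.hasSum_chF m hτ hz, fun r N => ?_⟩
  have h1 := KacWakimoto.chF_sub_sum_isBigO hm r (N + 1)
  have h2 := KacWakimoto.eulerFunction_sub_one_isBigO (N + 1)
  set X : ℝ → ℂ := fun t => KacWakimoto.chF m r (Complex.I * t) *
    (((2 * Real.exp (-(Real.pi / (4 * t)))) ^ m : ℝ) : ℂ) / t with hX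
  set E : ℝ → ℂ := fun t =>
    ∏' k : ℕ, (1 - ((Real.exp (-(2 * Real.pi / t)) : ℝ) : ℂ) ^ (k + 1)) with hE
  set S : ℝ → ℂ := fun t => ∑ k ∈ Finset.range (N + 1),
    KacWakimoto.coeffA k m r * ((t : ℂ) ^ k / (k.factorial : ℂ)) with hS
  -- The remainder is the exact difference, so the identity holds for all t > 0; its size comes from
  -- X E - S = X (E - 1) + (X - S) with X bounded near 0.
  refine ⟨fun t => X t * E t - S t, ?_, fun t ht => ?_⟩
  · have hone : (fun t : ℝ => t ^ (N + 1)) =O[𝓝[>] (0 : ℝ)] fun _ => (1 : ℝ) :=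
      ((continuous_pow (N + 1)).tendsto (0 : ℝ)).isBigO_one ℝ |>.mono nhdsWithin_le_nhds
    have hScont : Continuous S := by fun_prop
    have hSone : S =O[𝓝[>] (0 : ℝ)] fun _ => (1 : ℝ) :=
      (hScont.tendsto 0).isBigO_one ℝ |>.mono nhdsWithin_le_nhds
    have hXone : X =O[𝓝[>] (0 : ℝ)] fun _ => (1 : ℝ) :=
      ((h1.trans hone).add hSone).congr_left fun t => sub_add_cancel _ _
    have h3 := hXone.mul h2
    simp only [one_mul] at h3
    refine (h3.add h1).congr_left fun t => ?_
    simp only [hX, hE, hS]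
    ring
  · rw [KacWakimoto.trL_eq m r ht, add_sub_cancel]
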